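/- Let $g_0$ be a positive probability density on $\mathbb{R}$ that is unimodal about $c\in\mathbb{R}$ (non-decreasing on $(-\infty,c]$, non-increasing on $[c,\infty)$) with $g_0(c)<\infty$, and let $P_{g_0}$ be the corresponding probability measure and $\mathbb{E}_{g_0}$ the expectation under it. Let $M>0$, $\gamma\in(0,1)$, and $$\mathcal{F}=\{f:\ 0\le f(x)\le (Mg_0(x))^{1/(1-\gamma)}\ \ \forall x\in\mathbb{R},\ f \text{ is unimodal about } c\},\qquad \mathcal{L}=\{f/g_0: f\in\mathcal{F}\}.$$ Let $0\le m\le l$, let $\phi_0,\dots,\phi_l:\mathbb{R}\to\mathbb{R}$ be functions with $\mathbb{E}_{g_0}|\phi_j(X)|^{2+\delta}<\infty$ for $j=0,\dots,l$ and some $\delta>0$, and let $\mu_1,\dots,\mu_l\in\mathbb{R}$. (A typical equality constraint is $\phi_j\equiv 1$, $\mu_j=1$, which forces $f$ to be a probability density.) Consider $$(\mathcal{P})\quad \sup_{L\in\mathcal{L}}\ \mathbb{E}_{g_0}[\phi_0(X)L(X)]\quad\text{s.t. } \mathbb{E}_{g_0}[\phi_j(X)L(X)]\le\mu_j\ (1\le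 j\le m),\quad \mathbb{E}_{g_0}[\phi_j(X)L(X)]=\mu_j\ (m<j\le l),$$ and, for $X_1,X_2,\dots$ i.i.d. with density $g_0$ on a probability space $(\Omega,\mathcal{G},\mathbb{P})$, the importance-weighted sample average approximation (IW-SAA) $(\mathcal{P}_n)$, in which every $\mathbb{E}_{g_0}[\phi_j(X)L(X)]$ is replaced by $\frac1n\sum_{i=1}^n\phi_j(X_i)L(X_i)$. Write $val(\cdot)\in[-\infty,\infty]$ for the optimal value ($-\infty$ if infeasible). Assume the Slater condition: there is $L_0\in\mathcal{L}$ with $\mathbb{E}_{g_0}[\phi_jL_0]<\mu_j$ for $1\le j\le m$ and $\mathbb{E}_{g_0}[\phi_jL_0]=\mu_j$ for $m<j\le l$, and $(\mu_{m+1},\dots,\mu_l)$ is an interior point of $\{(\mathbb{E}_{g_0}[\phi_{m+1}L],\dots,\mathbb{E}_{g_0}[\phi_lL]):L\in\mathcal{L}\}$. Then: 1. Almost surely, for every $n\ge1$, $(\mathcal{P}_n)$ is equivalent to the finite-dimensional linear program $(\mathcal{P}'_n)$ with decision variables $L_i=L(X_i)$, $i=1,\dots,n$, that has the same objective and moment constraints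 as $(\mathcal{P}_n)$ and in which $L\in\mathcal{L}$ is replaced by the discrete shape constraint $$L(X_{(i-1)})g_0(X_{(i-1)})\le L(X_{(i)})g_0(X_{(i)})\ \text{ if } X_{(i)}\le c,\ 2\le i\le n,$$ $$L(X_{(i+1)})g_0(X_{(i+1)})\le L(X_{(i)})g_0(X_{(i)})\ \text{ if } X_{(i)}\ge c,\ 1\le i\le n-1,$$ $$0\le L(X_i)g_0(X_i)\le (Mg_0(X_i))^{1/(1-\gamma)},\quad i=1,\dots,n,$$ where $X_{(1)}\le\dots\le X_{(n)}$ are the order statistics. That is, the vectors satisfying the discrete shape constraint are exactly the vectors $(L(X_1),\dots,L(X_n))$ with $L\in\mathcal{L}$, the feasible points of $(\mathcal{P}'_n)$ are exactly the vectors $(L(X_1),\dots,L(X_n))$ with $L$ feasible for $(\mathcal{P}_n)$, and $val(\mathcal{P}_n)=val(\mathcal{P}'_n)$. 2. $|val(\mathcal{P}_n)-val(\mathcal{P})|\to0$ outer almost surely, i.e. the minimal measurable majorants of $|val(\mathcal{P}_n)-val(\mathcal{P})|$ converge to $0$ almost surely. 3. $\sqrt n\,(val(\mathcal{P}_n)-val(\mathcal{P}))=O_{\mathbb{P}^*}(1)$,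 i.e. for every $\varepsilon>0$ there is $K>0$ with $\limsup_{n\to\infty}\mathbb{P}^*\big(|\sqrt n(val(\mathcal{P}_n)-val(\mathcal{P}))|\ge K\big)\le\varepsilon$, where $\mathbb{P}^*$ is the outer probability. -/

import Mathlib

open MeasureTheory ProbabilityTheory Filter Topology
open scoped ENNReal Matrix

noncomputable section

namespace IWSAA

/-! ### Densities and the shape-constrained class -/

/-- `f` is unimodal about `c`: non-decreasing on `(-∞, c]`, non-increasing on `[c, ∞)`. -/
def UnimodalAbout (c : ℝ) (f : ℝ → ℝ) : Prop :=
  MonotoneOn f (Set.Iic c) ∧ AntitoneOn f (Set.Ici c)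

/-- `g` is a positive probability density on `ℝ` (with respect to Lebesgue measure). -/
def IsPositiveDensity (g : ℝ → ℝ) : Prop :=
  (∀ x, 0 < g x) ∧ Measurable g ∧ ∫⁻ x, ENNReal.ofReal (g x) = 1

/-- The probability measure `P_g` with density `g`. -/
def densityMeasure (g : ℝ → ℝ) : Measure ℝ :=
  volume.withDensity fun x => ENNReal.ofReal (g x)

/-- The class `𝓕` of functions `f` that are unimodal about `c` and satisfy
`0 ≤ f ≤ (M g₀)^(1/(1-γ))` everywhere. -/
def shapeClass (M γ c : ℝ) (g₀ : ℝ → ℝ) : Set (ℝ → ℝ) :=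
  {f | (∀ x, 0 ≤ f x ∧ f x ≤ (M * g₀ x) ^ (1 / (1 - γ))) ∧ UnimodalAbout c f}

/-- The class `𝓛 = {f / g : f ∈ 𝓕}` of likelihood ratios. -/
def likelihoodRatios (F : Set (ℝ → ℝ)) (g : ℝ → ℝ) : Set (ℝ → ℝ) :=
  (fun f x => f x / g x) '' F

/-! ### The optimization problems -/

/-- The data of a problem with `m` inequality and `k` equality moment constraints. -/
structure MomentData (m k : ℕ) where
  /-- the function in the objective -/
  obj : ℝ → ℝ
  /-- the functions in the inequality constraints -/
  ineq : Fin m → ℝ → ℝ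
  /-- the right-hand sides of the inequality constraints -/
  ineqBound : Fin m → ℝ
  /-- the functions in the equality constraints -/
  eq : Fin k → ℝ → ℝ
  /-- the right-hand sides of the equality constraints -/
  eqBound : Fin k → ℝ

variable {m k : ℕ}

/-- The feasible set: all `L ∈ 𝓛` that satisfy the moment constraints, where moments are taken
with the expectation operator `E`. -/
def feasibleSet (E : (ℝ → ℝ) → ℝ) (D : MomentData m k) (𝓛 : Set (ℝ → ℝ)) : Set (ℝ → ℝ) :=
  {L | L ∈ 𝓛 ∧ (∀ j, E (fun x => D.ineq j x * L x) ≤ D.ineqBound j) ∧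
    ∀ j, E (fun x => D.eq j x * L x) = D.eqBound j}

/-- The optimal value, in `[-∞, ∞]`: the supremum of the objective over the feasible set
(`-∞` if the problem is infeasible). -/
def optimalValue (E : (ℝ → ℝ) → ℝ) (D : MomentData m k) (𝓛 : Set (ℝ → ℝ)) : EReal :=
  ⨆ L ∈ feasibleSet E D 𝓛, ((E fun x => D.obj x * L x : ℝ) : EReal)

/-- The expectation `h ↦ 𝔼_g[h(X)]`. -/
def expect (g : ℝ → ℝ) (h : ℝ → ℝ) : ℝ := ∫ x, h x ∂(densityMeasure g)

/-- The sample average `h ↦ (1/n) ∑ h(xᵢ)`. -/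
def sampleMean {n : ℕ} (x : Fin n → ℝ) (h : ℝ → ℝ) : ℝ := (1 / (n : ℝ)) * ∑ i, h (x i)

/-- The sample points `X₀(ω), …, Xₙ₋₁(ω)`. -/
def sample {Ω : Type*} (X : ℕ → Ω → ℝ) (n : ℕ) (ω : Ω) : Fin n → ℝ := fun i => X i ω

/-- The Slater condition: some `L₀ ∈ 𝓛` satisfies all inequality constraints strictly and all
equality constraints, and the vector of right-hand sides of the equality constraints is interior
to the set of vectors of moments that `𝓛` attains. -/
def SlaterCondition (E : (ℝ → ℝ) → ℝ) (D : MomentData m k) (𝓛 : Set (ℝ → ℝ)) : Prop :=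
  (∃ L₀ ∈ 𝓛, (∀ j, E (fun x => D.ineq j x * L₀ x) < D.ineqBound j) ∧
    ∀ j, E (fun x => D.eq j x * L₀ x) = D.eqBound j) ∧
  D.eqBound ∈ interior ((fun (L : ℝ → ℝ) (j : Fin k) => E fun x => D.eq j x * L x) '' 𝓛)

/-! ### The discretized problem in the unknowns `v i = L(xᵢ)` -/

/-- The discrete shape constraint at the points `x 0, …, x (n - 1)`. The permutation
`Tuple.sort x` sorts the points, so `x (Tuple.sort x i)` are the order statistics. -/
def discreteShape (M γ c : ℝ) (g₀ : ℝ → ℝ) {n : ℕ} (x : Fin n → ℝ) : Set (Fin n → ℝ) :=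
  {v | (∀ i j : Fin n, (i : ℕ) + 1 = j → x (Tuple.sort x j) ≤ c →
        v (Tuple.sort x i) * g₀ (x (Tuple.sort x i)) ≤
          v (Tuple.sort x j) * g₀ (x (Tuple.sort x j))) ∧
    (∀ i j : Fin n, (i : ℕ) + 1 = j → c ≤ x (Tuple.sort x i) →
        v (Tuple.sort x j) * g₀ (x (Tuple.sort x j)) ≤
          v (Tuple.sort x i) * g₀ (x (Tuple.sort x i))) ∧
    ∀ i, 0 ≤ v i * g₀ (x i) ∧ v i * g₀ (x i) ≤ (M * g₀ (x i)) ^ (1 / (1 - γ))}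

/-- The objective of the discretized problem. -/
def discreteObjective (D : MomentData m k) {n : ℕ} (x : Fin n → ℝ) (v : Fin n → ℝ) : ℝ :=
  (1 / (n : ℝ)) * ∑ i, D.obj (x i) * v i

/-- The feasible set of the discretized problem with discrete shape constraint `S`. -/
def discreteFeasibleSet (D : MomentData m k) {n : ℕ} (x : Fin n → ℝ) (S : Set (Fin n → ℝ)) :
    Set (Fin n → ℝ) :=
  {v | v ∈ S ∧ (∀ j, (1 / (n : ℝ)) * ∑ i, D.ineq j (x i) * v i ≤ D.ineqBound j) ∧
    ∀ j, (1 / (n : ℝ)) * ∑ i, D.eq j (x i) * v i = D.eqBound j}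

/-- The optimal value of the discretized problem. -/
def discreteOptimalValue (D : MomentData m k) {n : ℕ} (x : Fin n → ℝ) (S : Set (Fin n → ℝ)) :
    EReal :=
  ⨆ v ∈ discreteFeasibleSet D x S, ((discreteObjective D x v : ℝ) : EReal)

/-- Optimizing `obj` over `S` is a (finite-dimensional) linear program: the objective is a linear
form and `S` is the solution set of finitely many linear inequalities. -/
def IsLinearProgram {n : ℕ} (obj : (Fin n → ℝ) → ℝ) (S : Set (Fin n → ℝ)) : Prop :=
  (∃ a : Fin n → ℝ, ∀ v, obj v = a ⬝ᵥ v) ∧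
  ∃ (N : ℕ) (A : Matrix (Fin N) (Fin n) ℝ) (b : Fin N → ℝ), S = {v | A *ᵥ v ≤ b}

/-! ### Convergence of possibly non-measurable maps

For an arbitrary set `B`, `P B` is in Mathlib the outer probability of `B`. -/

variable {Ω : Type*} [MeasurableSpace Ω]

/-- `U` is a minimal measurable majorant of the arbitrary map `T`. -/
def IsMinimalMajorant (P : Measure Ω) (T U : Ω → ℝ≥0∞) : Prop :=
  Measurable U ∧ (∀ ω, T ω ≤ U ω) ∧
    ∀ V : Ω → ℝ≥0∞, Measurable V → (∀ᵐ ω ∂P, T ω ≤ V ω) → ∀ᵐ ω ∂P, U ω ≤ V ω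

/-- The distance `|a - b|` in `[0, ∞]`; it is `∞` if `a` or `b` is infinite. -/
def gap (a b : EReal) : ℝ≥0∞ := (a - b).abs

/-- `Vₙ` converges to the constant `v` outer almost surely: the minimal measurable majorants of
`|Vₙ - v|` converge to zero almost surely. -/
def OuterAlmostSurelyTendsto (P : Measure Ω) (V : ℕ → Ω → EReal) (v : EReal) : Prop :=
  ∃ U : ℕ → Ω → ℝ≥0∞, (∀ n, IsMinimalMajorant P (fun ω => gap (V n ω) v) (U n)) ∧
    ∀ᵐ ω ∂P, Tendsto (fun n => U n ω) atTop (𝓝 0)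

/-- `√n (Vₙ - v)` is bounded in outer probability. -/
def RootNBounded (P : Measure Ω) (V : ℕ → Ω → EReal) (v : EReal) : Prop :=
  ∀ ε : ℝ, 0 < ε → ∃ K : ℝ, 0 < K ∧
    limsup (fun n : ℕ =>
      P {ω | ENNReal.ofReal K ≤ ENNReal.ofReal (Real.sqrt n) * gap (V n ω) v}) atTop
      ≤ ENNReal.ofReal ε

end IWSAA

end

namespace IWSAA

/-! ### Minimal measurable majorants -/

section Majorant

variable {Ω : Type*} [MeasurableSpace Ω]

/-! The proof has a discretization step, a deterministic stability estimate, and a uniform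
probabilistic bound.

Discretization: almost surely the sample points are distinct. A vector that obeys the discrete shape
constraint is then interpolated by the smallest nonnegative unimodal function above it. This
function respects the cap because `g₀`, and hence the cap, is unimodal about the same point `c`. So
restriction to the sample maps `𝓛` onto the discrete shape set
(`image_likelihoodRatios_eq_discreteShape`), and feasible sets and values follow.

Stability: under the Slater condition the value of a convex program is locally Lipschitz in its
moment map, for the sup norm over `𝓛` (`abstractValue_stable`). A nearly feasible point is repaired
by mixing it with a point that overshoots the constraints in the opposite direction.

Uniform bound: it remains to bound the supremum over `L ∈ 𝓛` of `|sample mean - expectation|` of `φ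
L` by measurable variables that have mean `O(1/√n)` and tend to zero almost surely. Split the line
by side of `c` and by dyadic level of `g₀`. On each shell, `φ L` is a fixed weight times a monotone
function with values in `[0, 1]`, which is a mixture of half-line indicators. Over half-lines,
ordering the sample turns the sums into partial sums, so symmetrization and Doob's inequality for
random signs give a bound of order `√n` times the `L²` norm of the weight. Since `1 / (1 - γ) > 1`,
the weights decay geometrically over the shells and the bounds add up. Almost sure convergence holds
along fourth powers because the means are summable, and the strong law fills the gaps.

Stability turns this bound into one for the optimal values. Markov's inequality then gives the rate,
and measurability of the bound gives the outer almost sure limit. -/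

/-- Every `[0, ∞]`-valued map has a minimal measurable majorant. -/
theorem exists_isMinimalMajorant (P : Measure Ω) [IsProbabilityMeasure P] (T : Ω → ℝ≥0∞) :
    ∃ U, IsMinimalMajorant P T U := by
  -- Each rational level is placed on a measurable hull of the set where `T` exceeds it; countably
  -- many levels keep the supremum measurable.
  refine ⟨fun ω => ⨆ q : ℚ, (toMeasurable P {ω | (Real.toNNReal q : ℝ≥0∞) < T ω}).indicator
    (fun _ => (Real.toNNReal q : ℝ≥0∞)) ω, ?_, ?_, ?_⟩
  · exact Measurable.iSup fun q => measurable_const.indicator (measurableSet_toMeasurable _ _)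
  · intro ω
    refine le_of_forall_lt fun a ha => ?_
    obtain ⟨q, -, haq, hqT⟩ := ENNReal.lt_iff_exists_rat_btwn.1 ha
    refine haq.trans_le (le_iSup_of_le q ?_)
    rw [Set.indicator_of_mem]
    exact subset_toMeasurable _ _ hqT
  · intro V hV hTV
    have key : ∀ q : ℚ, ∀ᵐ ω ∂P,
        (toMeasurable P {ω | (Real.toNNReal q : ℝ≥0∞) < T ω}).indicator
          (fun _ => (Real.toNNReal q : ℝ≥0∞)) ω ≤ V ω := by
      intro q
      set A := {ω | (Real.toNNReal q : ℝ≥0∞) < T ω} with hA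
      set B := {ω | (Real.toNNReal q : ℝ≥0∞) < V ω} with hB
      have hBm : MeasurableSet B := measurableSet_lt measurable_const hV
      have hAB : A ≤ᵐ[P] B := by
        filter_upwards [hTV] with ω hω h
        exact lt_of_lt_of_le h hω
      have h1 : P (A ∩ B) = P A := by
        refine measure_congr ?_
        filter_upwards [hAB] with ω hω
        exact propext ⟨fun h => h.1, fun h => ⟨h, hω h⟩⟩
      -- The hull and `A` have the same outer measure inside every measurable set. Taking the set
      -- `B`, the hull lies in `B` up to a null set although `A` may be non-measurable.
      have h2 : P (toMeasurable P A ∩ B) = P A := by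
        rw [Measure.measure_toMeasurable_inter hBm (measure_ne_top _ _), h1]
      have h3 : P (toMeasurable P A \ B) = 0 := by
        have := measure_inter_add_sdiff (μ := P) (toMeasurable P A) hBm
        rw [h2, measure_toMeasurable] at this
        exact (ENNReal.add_right_inj (measure_ne_top P A)).1 (this.trans (add_zero _).symm)
      have h4 : ∀ᵐ ω ∂P, ω ∉ toMeasurable P A \ B := measure_eq_zero_iff_ae_notMem.1 h3
      filter_upwards [h4] with ω hω
      by_cases hmem : ω ∈ toMeasurable P A
      · rw [Set.indicator_of_mem hmem]
        by_contra hlt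
        exact hω ⟨hmem, fun hb => hlt (le_of_lt hb)⟩
      · rw [Set.indicator_of_notMem hmem]
        exact zero_le
    filter_upwards [ae_all_iff.2 key] with ω hω
    exact iSup_le hω

/-- A sequence whose gap to `v` is dominated almost surely by measurable maps that converge to zero
converges outer almost surely. -/
theorem OuterAlmostSurelyTendsto.of_le {P : Measure Ω} [IsProbabilityMeasure P]
    {V : ℕ → Ω → EReal} {v : EReal} (B : ℕ → Ω → ℝ≥0∞) (hB : ∀ n, Measurable (B n))
    (hle : ∀ n, 1 ≤ n → ∀ᵐ ω ∂P, gap (V n ω) v ≤ B n ω)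
    (hlim : ∀ᵐ ω ∂P, Tendsto (fun n => B n ω) atTop (𝓝 0)) :
    OuterAlmostSurelyTendsto P V v := by
  choose U hU using fun n => exists_isMinimalMajorant P (fun ω => gap (V n ω) v)
  refine ⟨U, hU, ?_⟩
  have h : ∀ᵐ ω ∂P, ∀ n, 1 ≤ n → U n ω ≤ B n ω := by
    rw [ae_all_iff]
    intro n
    by_cases hn : 1 ≤ n
    · filter_upwards [(hU n).2.2 (B n) (hB n) (hle n hn)] with ω hω _ using hω
    · exact ae_of_all _ fun ω h => absurd h hn
  filter_upwards [h, hlim] with ω h1 h2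
  refine tendsto_of_tendsto_of_tendsto_of_le_of_le' tendsto_const_nhds h2
    (Eventually.of_forall fun _ => zero_le) ?_
  filter_upwards [eventually_ge_atTop 1] with n hn using h1 n hn

end Majorant

/-! ### Stability of convex programs under the Slater condition -/

theorem gap_le_ofReal {a b : EReal} {K : ℝ} (hb : b ≠ ⊥) (hb' : b ≠ ⊤)
    (hab : a ≤ b + (K : EReal)) (hba : b ≤ a + (K : EReal)) :
    gap a b ≤ ENNReal.ofReal K := by
  lift b to ℝ using ⟨hb', hb⟩
  induction a with
  | bot => simp at hba
  | top =>
    rw [← EReal.coe_add] at hab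
    exact absurd hab (not_le.2 (EReal.coe_lt_top _))
  | coe a =>
    have h1 : a ≤ b + K := by exact_mod_cast hab
    have h2 : b ≤ a + K := by exact_mod_cast hba
    unfold gap
    rw [← EReal.coe_sub, EReal.abs_def]
    apply ENNReal.ofReal_le_ofReal
    rw [abs_le]
    constructor <;> linarith

/-- A convex set that is `Δ`-dense in a closed ball of radius `r > Δ` contains the open ball of
radius `r - Δ`. -/
theorem ball_subset_of_convex_of_dense {k : ℕ} {A : Set (Fin k → ℝ)} (hA : Convex ℝ A)
    {y₀ : Fin k → ℝ} {r Δ : ℝ} (hΔ : 0 ≤ Δ) (hr : Δ < r)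
    (hd : ∀ y ∈ Metric.closedBall y₀ r, ∃ a ∈ A, ‖a - y‖ ≤ Δ) :
    Metric.ball y₀ (r - Δ) ⊆ A := by
  have hcl : Metric.ball y₀ (r - Δ) ⊆ closure A := by
    intro y hy
    by_contra hyA
    obtain ⟨f, u, hfu, huy⟩ := geometric_hahn_banach_closed_point hA.closure isClosed_closure hyA
    let e : Fin k → Fin k → ℝ := fun j => Pi.single j 1
    have hf : ∀ z : Fin k → ℝ, f z = ∑ j, z j * f (e j) := by
      intro z
      conv_lhs => rw [pi_eq_sum_univ' z]
      rw [map_sum]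
      refine Finset.sum_congr rfl fun j _ => ?_
      rw [map_smul, smul_eq_mul]
    -- `z` moves `y` by at most `Δ` in the direction in which `f` grows fastest for the sup norm. A
    -- point of `A` within `Δ` of `z` loses at most this gain, so `f` is there at least `f y`,
    -- against the separation.
    let z : Fin k → ℝ := fun j => y j + Δ * SignType.sign (f (e j))
    have hsign : ∀ x : ℝ, |((SignType.sign x : SignType) : ℝ)| ≤ 1 := by
      intro x
      rcases lt_trichotomy x 0 with h | h | h <;> simp [h]
    have hz : z ∈ Metric.closedBall y₀ r := by
      rw [mem_closedBall_iff_norm]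
      have h1 : ‖z - y‖ ≤ Δ := by
        rw [pi_norm_le_iff_of_nonneg hΔ]
        intro j
        simp only [z, Pi.sub_apply, add_sub_cancel_left, Real.norm_eq_abs, abs_mul,
          abs_of_nonneg hΔ]
        exact mul_le_of_le_one_right hΔ (hsign _)
      have h2 : ‖y - y₀‖ < r - Δ := mem_ball_iff_norm.1 hy
      calc ‖z - y₀‖ = ‖(z - y) + (y - y₀)‖ := by rw [sub_add_sub_cancel]
        _ ≤ ‖z - y‖ + ‖y - y₀‖ := norm_add_le _ _
        _ ≤ r := by linarith
    obtain ⟨a, ha, haz⟩ := hd z hz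
    have h3 : f z = f y + ∑ j, Δ * |f (e j)| := by
      rw [hf z, hf y, ← Finset.sum_add_distrib]
      refine Finset.sum_congr rfl fun j _ => ?_
      simp only [z]
      rw [add_mul, mul_assoc, sign_mul_self]
    have h4 : f z - f a ≤ ∑ j, Δ * |f (e j)| := by
      rw [← map_sub, hf (z - a)]
      refine Finset.sum_le_sum fun j _ => ?_
      refine (le_abs_self _).trans ?_
      rw [abs_mul]
      refine mul_le_mul_of_nonneg_right ?_ (abs_nonneg _)
      have := norm_le_pi_norm (a - z) j
      rw [Pi.sub_apply, abs_sub_comm]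
      exact this.trans haz
    have h5 := hfu a (subset_closure ha)
    linarith
  have hpos : 0 < r - Δ := sub_pos.2 hr
  -- Affine subspaces are closed in finite dimension, so `A` spans as much as its closure. Hence `A`
  -- has interior points, and then it has the same interior as its closure.
  have hspan : affineSpan ℝ A = ⊤ := by
    have h1 : affineSpan ℝ (closure A) = ⊤ := by
      have hne : (interior (closure A)).Nonempty :=
        ⟨y₀, interior_maximal hcl Metric.isOpen_ball (Metric.mem_ball_self hpos)⟩
      exact hA.closure.interior_nonempty_iff_affineSpan_eq_top.1 hne
    have h2 : closure A ⊆ affineSpan ℝ A :=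
      closure_minimal (subset_affineSpan ℝ A) (AffineSubspace.closed_of_finiteDimensional _)
    rw [eq_top_iff, ← h1]
    exact affineSpan_le.2 h2
  have hne : (interior A).Nonempty := (hA.interior_nonempty_iff_affineSpan_eq_top).2 hspan
  calc Metric.ball y₀ (r - Δ) ⊆ interior (closure A) := interior_maximal hcl Metric.isOpen_ball
    _ = interior A := hA.interior_closure_eq_interior_of_nonempty_interior hne
    _ ⊆ A := interior_subset

section Stability

variable {m k : ℕ} {V : Type*} [AddCommGroup V] [Module ℝ V]

/-- Values of the objective, of the inequality and of the equality constraint functions. -/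
abbrev MomentSpace (m k : ℕ) : Type := ℝ × (Fin m → ℝ) × (Fin k → ℝ)

/-- The map `u` is affine along segments of `S`. -/
def SegmentAffine (S : Set V) (u : V → MomentSpace m k) : Prop :=
  ∀ x ∈ S, ∀ y ∈ S, ∀ a b : ℝ, 0 ≤ a → 0 ≤ b → a + b = 1 → u (a • x + b • y) = a • u x + b • u y

/-- The points of `S` that satisfy the constraints. -/
def abstractFeasible (S : Set V) (u : V → MomentSpace m k) (bi : Fin m → ℝ) (be : Fin k → ℝ) :
    Set V :=
  {x | x ∈ S ∧ (∀ j, (u x).2.1 j ≤ bi j) ∧ ∀ j, (u x).2.2 j = be j}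

/-- The optimal value of the program with moment map `u`. -/
noncomputable def abstractValue (S : Set V) (u : V → MomentSpace m k) (bi : Fin m → ℝ)
    (be : Fin k → ℝ) : EReal :=
  ⨆ x ∈ abstractFeasible S u bi be, ((u x).1 : EReal)

/-- The Slater condition with slack `s`, uniformly over right-hand sides at distance `≤ r`. -/
def RobustSlater (S : Set V) (u : V → MomentSpace m k) (bi : Fin m → ℝ) (be : Fin k → ℝ)
    (r s : ℝ) : Prop :=
  ∀ d ∈ Metric.closedBall be r, ∃ x ∈ S, (∀ j, (u x).2.1 j ≤ bi j - s) ∧ (u x).2.2 = d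

theorem abs_objective_le {w : MomentSpace m k} {B : ℝ} (h : ‖w‖ ≤ B) : |w.1| ≤ B :=
  (norm_fst_le w).trans h

theorem abs_ineq_le {w : MomentSpace m k} {B : ℝ} (h : ‖w‖ ≤ B) (j : Fin m) : |w.2.1 j| ≤ B :=
  ((norm_le_pi_norm w.2.1 j).trans ((norm_fst_le w.2).trans (norm_snd_le w))).trans h

theorem norm_eq_le {w : MomentSpace m k} {B : ℝ} (h : ‖w‖ ≤ B) : ‖w.2.2‖ ≤ B :=
  ((norm_snd_le w.2).trans (norm_snd_le w)).trans h

/-- Interiority supplies points of `S` with any equality moments near `be`, but without control of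
the inequalities. A small admixture of such a point to the Slater point shifts the equality moments
and keeps half of the slack. -/
theorem exists_robustSlater {S : Set V} (hS : Convex ℝ S) {u : V → MomentSpace m k}
    (hu : SegmentAffine S u) {B : ℝ} (hB : ∀ x ∈ S, ‖u x‖ ≤ B) {bi : Fin m → ℝ} {be : Fin k → ℝ}
    (hslater : ∃ x ∈ S, (∀ j, (u x).2.1 j < bi j) ∧ ∀ j, (u x).2.2 j = be j)
    (hint : be ∈ interior ((fun x => (u x).2.2) '' S)) :
    ∃ r > 0, ∃ s > 0, RobustSlater S u bi be r s := by
  obtain ⟨x₀, hx₀, hlt, heq⟩ := hslater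
  have hB0 : 0 ≤ B := (norm_nonneg _).trans (hB x₀ hx₀)
  obtain ⟨s₀, hs₀, hgap⟩ : ∃ s₀ > 0, ∀ j, (u x₀).2.1 j ≤ bi j - s₀ := by
    rcases isEmpty_or_nonempty (Fin m) with hm | hm
    · exact ⟨1, one_pos, fun j => (hm.false j).elim⟩
    · obtain ⟨j₀, hj₀⟩ := Finite.exists_min fun j => bi j - (u x₀).2.1 j
      exact ⟨bi j₀ - (u x₀).2.1 j₀, sub_pos.2 (hlt j₀), fun j => by linarith [hj₀ j]⟩
  obtain ⟨r₀, hr₀, hball⟩ :=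
    Metric.nhds_basis_closedBall.mem_iff.1 (mem_interior_iff_mem_nhds.1 hint)
  -- Mixing with weight `τ` changes an inequality moment by at most `2 * τ * B`, which this choice
  -- keeps at or below `s₀ / 2`.
  set τ : ℝ := s₀ / (s₀ + 4 * B) with hτ
  have hden : 0 < s₀ + 4 * B := by positivity
  have hτ0 : 0 < τ := by positivity
  have hτ1 : τ ≤ 1 := by rw [hτ, div_le_one hden]; linarith
  have hτB : 2 * τ * B ≤ s₀ / 2 := by
    have : τ * (s₀ + 4 * B) = s₀ := div_mul_cancel₀ _ hden.ne'
    nlinarith [mul_pos hτ0 hs₀]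
  refine ⟨τ * r₀, by positivity, s₀ / 2, by positivity, fun d hd => ?_⟩
  have hd' : be + τ⁻¹ • (d - be) ∈ Metric.closedBall be r₀ := by
    rw [mem_closedBall_iff_norm, add_sub_cancel_left, norm_smul, norm_inv, Real.norm_eq_abs,
      abs_of_pos hτ0, inv_mul_le_iff₀ hτ0]
    exact mem_closedBall_iff_norm.1 hd
  obtain ⟨x₁, hx₁, hux₁⟩ := hball hd'
  have hcomb := hu x₀ hx₀ x₁ hx₁ (1 - τ) τ (by linarith) hτ0.le (by ring)
  refine ⟨(1 - τ) • x₀ + τ • x₁, hS hx₀ hx₁ (by linarith) hτ0.le (by ring), fun j => ?_, ?_⟩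
  · rw [hcomb]
    have h1 := abs_le.1 (abs_ineq_le (hB x₁ hx₁) j)
    have h0 := abs_le.1 (abs_ineq_le (hB x₀ hx₀) j)
    simp only [Prod.snd_add, Prod.fst_add, Prod.smul_snd, Prod.smul_fst, Pi.add_apply,
      Pi.smul_apply, smul_eq_mul]
    nlinarith [hgap j]
  · rw [hcomb]
    have h0 : (u x₀).2.2 = be := funext heq
    simp only at hux₁
    simp only [Prod.snd_add, Prod.smul_snd, h0, hux₁]
    rw [smul_add, smul_smul, mul_inv_cancel₀ hτ0.ne', one_smul, sub_smul, one_smul]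
    abel

/-- The slack survives up to `Δ`, but the equality moments under `w` only approximate the prescribed
ones. They form a convex set that is `Δ`-dense in the ball of radius `r`, and such a set contains
the ball of radius `r / 2`. -/
theorem RobustSlater.perturb {S : Set V} (hS : Convex ℝ S) {u w : V → MomentSpace m k}
    (hu : SegmentAffine S u) (hw : SegmentAffine S w) {bi : Fin m → ℝ} {be : Fin k → ℝ}
    {r s Δ : ℝ} (h : RobustSlater S u bi be r s) (hΔ : 0 ≤ Δ) (hr : 2 * Δ < r) (hs : 2 * Δ ≤ s)
    (huw : ∀ x ∈ S, ‖w x - u x‖ ≤ Δ) : RobustSlater S w bi be (r / 2) (s / 2) := by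
  set A : Set (Fin k → ℝ) := (fun x => (w x).2.2) '' {x | x ∈ S ∧ ∀ j, (u x).2.1 j ≤ bi j - s}
  have hA : Convex ℝ A := by
    rintro _ ⟨x, ⟨hx, hxi⟩, rfl⟩ _ ⟨y, ⟨hy, hyi⟩, rfl⟩ a b ha hb hab
    refine ⟨a • x + b • y, ⟨hS hx hy ha hb hab, fun j => ?_⟩, ?_⟩
    · rw [hu x hx y hy a b ha hb hab]
      simp only [Prod.snd_add, Prod.fst_add, Prod.smul_snd, Prod.smul_fst, Pi.add_apply,
        Pi.smul_apply, smul_eq_mul]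
      calc a * (u x).2.1 j + b * (u y).2.1 j ≤ a * (bi j - s) + b * (bi j - s) := by
            gcongr
            · exact hxi j
            · exact hyi j
        _ = bi j - s := by rw [← add_mul, hab, one_mul]
    · simp only [hw x hx y hy a b ha hb hab, Prod.snd_add, Prod.smul_snd]
  have hdense : ∀ y ∈ Metric.closedBall be r, ∃ a ∈ A, ‖a - y‖ ≤ Δ := by
    intro y hy
    obtain ⟨x, hx, hxi, rfl⟩ := h y hy
    exact ⟨_, ⟨x, ⟨hx, hxi⟩, rfl⟩, norm_eq_le (huw x hx)⟩
  have hsub := ball_subset_of_convex_of_dense hA hΔ (by linarith) hdense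
  intro d hd
  obtain ⟨x, ⟨hx, hxi⟩, hxd⟩ := hsub (Metric.closedBall_subset_ball (by linarith) hd)
  refine ⟨x, hx, fun j => ?_, hxd⟩
  have h1 : |(w x).2.1 j - (u x).2.1 j| ≤ Δ := abs_ineq_le (huw x hx) j
  linarith [(abs_le.1 h1).2, hxi j]

/-- Under a robust Slater condition, an almost feasible point can be made feasible at a cost
proportional to its infeasibility. -/
theorem RobustSlater.repair {S : Set V} (hS : Convex ℝ S) {w : V → MomentSpace m k}
    (hw : SegmentAffine S w) {B : ℝ} (hB : ∀ x ∈ S, ‖w x‖ ≤ B) {bi : Fin m → ℝ} {be : Fin k → ℝ}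
    {ρ Δ : ℝ} (h : RobustSlater S w bi be ρ ρ) (hρ : 0 < ρ) (hΔ : 0 < Δ) {x : V} (hx : x ∈ S)
    (hxi : ∀ j, (w x).2.1 j ≤ bi j + Δ) (hxe : ‖(w x).2.2 - be‖ ≤ Δ) :
    ∃ y ∈ abstractFeasible S w bi be, (w x).1 ≤ (w y).1 + 2 * B / ρ * Δ := by
  have hB0 : 0 ≤ B := (norm_nonneg _).trans (hB x hx)
  -- The target lies opposite to the equality error, magnified by `ρ / Δ`. Mixing with weights in
  -- the ratio `ρ : Δ` cancels the error exactly, and the slack `ρ` absorbs the inequality violation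
  -- `Δ`.
  have hd : be - (ρ / Δ) • ((w x).2.2 - be) ∈ Metric.closedBall be ρ := by
    rw [mem_closedBall_iff_norm, sub_sub_cancel_left, norm_neg, norm_smul, Real.norm_eq_abs,
      abs_of_pos (by positivity)]
    calc ρ / Δ * ‖(w x).2.2 - be‖ ≤ ρ / Δ * Δ := by gcongr
      _ = ρ := div_mul_cancel₀ _ hΔ.ne'
  obtain ⟨x₁, hx₁, hx₁i, hx₁e⟩ := h _ hd
  have hsum : 0 < Δ + ρ := by positivity
  set a := ρ / (Δ + ρ) with ha
  set b := Δ / (Δ + ρ) with hb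
  have ha0 : 0 ≤ a := by positivity
  have hb0 : 0 ≤ b := by positivity
  have hab : a + b = 1 := by rw [ha, hb]; field_simp; ring
  have hbal : a * Δ = b * ρ := by rw [ha, hb]; field_simp
  have hcomb := hw x hx x₁ hx₁ a b ha0 hb0 hab
  refine ⟨a • x + b • x₁, ⟨hS hx hx₁ ha0 hb0 hab, fun j => ?_, fun j => ?_⟩, ?_⟩
  · rw [hcomb]
    simp only [Prod.snd_add, Prod.fst_add, Prod.smul_snd, Prod.smul_fst, Pi.add_apply,
      Pi.smul_apply, smul_eq_mul]
    calc a * (w x).2.1 j + b * (w x₁).2.1 j ≤ a * (bi j + Δ) + b * (bi j - ρ) := by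
          gcongr
          · exact hxi j
          · exact hx₁i j
      _ = (a + b) * bi j + (a * Δ - b * ρ) := by ring
      _ = bi j := by rw [hab, hbal]; ring
  · rw [hcomb]
    have hbρ : b * (ρ / Δ) = a := by
      rw [← mul_div_assoc, ← hbal, mul_div_assoc, div_self hΔ.ne', mul_one]
    simp only [Prod.snd_add, Prod.smul_snd, Pi.add_apply, Pi.smul_apply, smul_eq_mul, hx₁e,
      Pi.sub_apply]
    calc a * (w x).2.2 j + b * (be j - ρ / Δ * ((w x).2.2 j - be j))
        = a * (w x).2.2 j + b * be j - b * (ρ / Δ) * ((w x).2.2 j - be j) := by ring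
      _ = (a + b) * be j := by rw [hbρ]; ring
      _ = be j := by rw [hab, one_mul]
  · rw [hcomb]
    simp only [Prod.fst_add, Prod.smul_fst, smul_eq_mul]
    have h0 := abs_le.1 (abs_objective_le (hB x hx))
    have h1 := abs_le.1 (abs_objective_le (hB x₁ hx₁))
    have hbΔ : b ≤ Δ / ρ := by
      rw [hb]; gcongr; linarith
    have ha' : a = 1 - b := by linarith
    have h2 : b * (2 * B) ≤ Δ / ρ * (2 * B) := by gcongr
    have h3 : 2 * B / ρ * Δ = Δ / ρ * (2 * B) := by ring
    rw [h3, ha']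
    nlinarith

/-- Under the Slater condition, the optimal value depends on the moment map in a locally Lipschitz
way. -/
theorem abstractValue_stable {S : Set V} (hS : Convex ℝ S) {u : V → MomentSpace m k}
    (hu : SegmentAffine S u) {B : ℝ} (hB : ∀ x ∈ S, ‖u x‖ ≤ B) {bi : Fin m → ℝ} {be : Fin k → ℝ}
    (hslater : ∃ x ∈ S, (∀ j, (u x).2.1 j < bi j) ∧ ∀ j, (u x).2.2 j = be j)
    (hint : be ∈ interior ((fun x => (u x).2.2) '' S)) :
    ∃ η > 0, ∃ C > 0, ∀ w : V → MomentSpace m k, SegmentAffine S w → ∀ Δ > 0, Δ ≤ η →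
      (∀ x ∈ S, ‖w x - u x‖ ≤ Δ) →
      gap (abstractValue S w bi be) (abstractValue S u bi be) ≤ ENNReal.ofReal (C * Δ) := by
  obtain ⟨r, hr, s, hs, hrob⟩ := exists_robustSlater hS hu hB hslater hint
  set ρ := min (r / 2) (s / 2) with hρdef
  have hρ : 0 < ρ := by positivity
  have hmono : ∀ w : V → MomentSpace m k, RobustSlater S w bi be (r / 2) (s / 2) →
      RobustSlater S w bi be ρ ρ := by
    intro w hw d hd
    obtain ⟨x, hx, hxi, hxe⟩ := hw d (Metric.closedBall_subset_closedBall (min_le_left _ _) hd)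
    exact ⟨x, hx, fun j => (hxi j).trans (by linarith [min_le_right (r / 2) (s / 2)]), hxe⟩
  have hB0 : 0 ≤ B := by
    obtain ⟨x, hx, -⟩ := hslater
    exact (norm_nonneg _).trans (hB x hx)
  set K := 2 * (B + 1) / ρ with hK
  -- one direction of the estimate, for an arbitrary pair of moment maps
  have main : ∀ (v w : V → MomentSpace m k) (Δ : ℝ), SegmentAffine S w → 0 < Δ →
      (∀ x ∈ S, ‖w x‖ ≤ B + 1) → RobustSlater S w bi be ρ ρ → (∀ x ∈ S, ‖w x - v x‖ ≤ Δ) →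
      abstractValue S v bi be ≤ abstractValue S w bi be + ((K + 1) * Δ : ℝ) := by
    intro v w Δ hw hΔ hwB hwr hvw
    refine iSup₂_le fun x hx => ?_
    obtain ⟨hxS, hxi, hxe⟩ := hx
    have h1 : ∀ j, (w x).2.1 j ≤ bi j + Δ := fun j => by
      have h1 : |(w x).2.1 j - (v x).2.1 j| ≤ Δ := abs_ineq_le (hvw x hxS) j
      linarith [(abs_le.1 h1).2, hxi j]
    have h2 : ‖(w x).2.2 - be‖ ≤ Δ := by
      have h2 : ‖(w x).2.2 - (v x).2.2‖ ≤ Δ := norm_eq_le (hvw x hxS)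
      rwa [show (v x).2.2 = be from funext hxe] at h2
    obtain ⟨y, hy, hxy⟩ := hwr.repair hS hw hwB hρ hΔ hxS h1 h2
    have h3 : |(w x).1 - (v x).1| ≤ Δ := abs_objective_le (hvw x hxS)
    have h4 : (v x).1 ≤ (w y).1 + (K + 1) * Δ := by
      rw [hK]; linarith [(abs_le.1 h3).1]
    calc ((v x).1 : EReal) ≤ (((w y).1 + (K + 1) * Δ : ℝ) : EReal) := EReal.coe_le_coe_iff.2 h4
      _ = ((w y).1 : EReal) + ((K + 1) * Δ : ℝ) := EReal.coe_add _ _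
      _ ≤ _ := by
        gcongr
        exact le_iSup₂_of_le y hy le_rfl
  -- A perturbation of size zero, so that `u` and `w` share the same halved constants.
  have hu' : RobustSlater S u bi be (r / 2) (s / 2) :=
    hrob.perturb hS hu hu le_rfl (by linarith) (by linarith) fun x _ => by simp
  have hne : abstractValue S u bi be ≠ ⊥ := by
    obtain ⟨x, hx, hxi, hxe⟩ := hslater
    refine ne_bot_of_le_ne_bot (EReal.coe_ne_bot (u x).1) ?_
    exact le_iSup₂_of_le x ⟨hx, fun j => (hxi j).le, hxe⟩ le_rfl
  have hnt : abstractValue S u bi be ≠ ⊤ := by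
    refine ne_top_of_le_ne_top (EReal.coe_ne_top B) (iSup₂_le fun x hx => ?_)
    exact EReal.coe_le_coe_iff.2 ((le_abs_self _).trans (abs_objective_le (hB x hx.1)))
  -- The bound `ρ / 2` meets the smallness demanded by `RobustSlater.perturb`; the bound `1` gives
  -- `‖w x‖ ≤ B + 1`, from which `K` is built.
  refine ⟨min (ρ / 2) 1, by positivity, K + 1, by positivity, fun w hw Δ hΔ hΔη huw => ?_⟩
  have hΔρ : Δ ≤ ρ / 2 := hΔη.trans (min_le_left _ _)
  have hΔ1 : Δ ≤ 1 := hΔη.trans (min_le_right _ _)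
  have hρr : ρ ≤ r / 2 := min_le_left _ _
  have hρs : ρ ≤ s / 2 := min_le_right _ _
  have hwr : RobustSlater S w bi be (r / 2) (s / 2) :=
    hrob.perturb hS hu hw hΔ.le (by linarith) (by linarith) huw
  have hwB : ∀ x ∈ S, ‖w x‖ ≤ B + 1 := fun x hx => by
    calc ‖w x‖ = ‖u x + (w x - u x)‖ := by rw [add_sub_cancel]
      _ ≤ ‖u x‖ + ‖w x - u x‖ := norm_add_le _ _
      _ ≤ B + 1 := add_le_add (hB x hx) ((huw x hx).trans hΔ1)
  refine gap_le_ofReal hne hnt ?_ ?_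
  · exact main w u Δ hu hΔ (fun x hx => (hB x hx).trans (by linarith)) (hmono u hu')
      fun x hx => by rw [norm_sub_rev]; exact huw x hx
  · exact main u w Δ hw hΔ hwB (hmono w hwr) huw

end Stability

/-! ### Reduction of the sampled problem to a linear program -/

section Discretization

variable {M γ c : ℝ} {g₀ : ℝ → ℝ} {n : ℕ} {x : Fin n → ℝ}

theorem sort_monotone (x : Fin n → ℝ) {i j : Fin n} (h : i ≤ j) :
    x (Tuple.sort x i) ≤ x (Tuple.sort x j) :=
  Tuple.monotone_sort x h

theorem exists_sort_lt {a b : Fin n} (h : x a < x b) :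
    ∃ i j : Fin n, i < j ∧ Tuple.sort x i = a ∧ Tuple.sort x j = b := by
  refine ⟨(Tuple.sort x).symm a, (Tuple.sort x).symm b, ?_, by simp, by simp⟩
  by_contra hle
  have := sort_monotone x (not_lt.1 hle)
  simp only [Equiv.apply_symm_apply] at this
  exact absurd h (not_lt.2 this)

/-- A function on `Fin n` that is monotone along the consecutive pairs between `i` and `j`. -/
theorem le_of_le_succ_between {q : Fin n → ℝ} {i j : Fin n} (hij : i ≤ j)
    (hq : ∀ k l : Fin n, i ≤ k → l ≤ j → (k : ℕ) + 1 = l → q k ≤ q l) : q i ≤ q j := by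
  obtain ⟨d, hd⟩ : ∃ d : ℕ, (j : ℕ) = i + d := ⟨j - i, by have : (i : ℕ) ≤ j := hij; omega⟩
  induction d generalizing j with
  | zero => rw [show i = j from Fin.ext (by omega)]
  | succ d ih =>
    let j' : Fin n := ⟨i + d, by have := j.2; omega⟩
    have hj' : j' ≤ j := by show (i : ℕ) + d ≤ j; omega
    have hij' : i ≤ j' := by show (i : ℕ) ≤ i + d; omega
    exact (ih hij' (fun k l hk hl => hq k l hk (hl.trans hj')) rfl).trans
      (hq j' j hij' le_rfl (by simp only [j']; omega))

/-- The constraints between consecutive order statistics chain together, as every sorted point from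
`a` to `b` is still at most `c`. Injectivity settles ties, where the sorting permutation alone
decides the direction of the inequality. -/
theorem discreteShape_left (hx : Function.Injective x) {v : Fin n → ℝ}
    (hv : v ∈ discreteShape M γ c g₀ x) {a b : Fin n} (hab : x a ≤ x b) (hb : x b ≤ c) :
    v a * g₀ (x a) ≤ v b * g₀ (x b) := by
  rcases hab.eq_or_lt with h | h
  · rw [hx h]
  obtain ⟨i, j, hij, rfl, rfl⟩ := exists_sort_lt h
  exact le_of_le_succ_between (q := fun i => v (Tuple.sort x i) * g₀ (x (Tuple.sort x i))) hij.le
    fun k l _ hl hkl => hv.1 k l hkl ((sort_monotone x hl).trans hb)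

theorem discreteShape_right (hx : Function.Injective x) {v : Fin n → ℝ}
    (hv : v ∈ discreteShape M γ c g₀ x) {a b : Fin n} (hab : x a ≤ x b) (ha : c ≤ x a) :
    v b * g₀ (x b) ≤ v a * g₀ (x a) := by
  rcases hab.eq_or_lt with h | h
  · rw [hx h]
  obtain ⟨i, j, hij, rfl, rfl⟩ := exists_sort_lt h
  exact neg_le_neg_iff.1 <| le_of_le_succ_between
    (q := fun i => -(v (Tuple.sort x i) * g₀ (x (Tuple.sort x i)))) hij.le
    fun k l hk _ hkl => neg_le_neg (hv.2.1 k l hkl (ha.trans (sort_monotone x hk)))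

/-- The smallest function that is unimodal about `c`, nonnegative, and at least `w i` at `x i`. -/
noncomputable def unimodalHull (c : ℝ) (x w : Fin n → ℝ) (y : ℝ) : ℝ :=
  ⨆ i, if (x i ≤ y ∧ y ≤ c) ∨ (c ≤ y ∧ y ≤ x i) then max (w i) 0 else 0

theorem le_unimodalHull (c : ℝ) (x w : Fin n → ℝ) (y : ℝ) (i : Fin n)
    (h : (x i ≤ y ∧ y ≤ c) ∨ (c ≤ y ∧ y ≤ x i)) : w i ≤ unimodalHull c x w y := by
  refine le_trans ?_ (le_ciSup (Set.finite_range _).bddAbove i)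
  rw [if_pos h]
  exact le_max_left _ _

theorem unimodalHull_nonneg (c : ℝ) (x w : Fin n → ℝ) (y : ℝ) : 0 ≤ unimodalHull c x w y := by
  refine Real.iSup_nonneg fun i => ?_
  split_ifs
  · exact le_max_right _ _
  · exact le_rfl

theorem unimodalHull_le (c : ℝ) (x w : Fin n → ℝ) (y : ℝ) {b : ℝ} (hb : 0 ≤ b)
    (h : ∀ i, (x i ≤ y ∧ y ≤ c) ∨ (c ≤ y ∧ y ≤ x i) → w i ≤ b) : unimodalHull c x w y ≤ b := by
  refine Real.iSup_le (fun i => ?_) hb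
  split_ifs with hi
  · exact max_le (h i hi) hb
  · exact hb

/-- As `y` moves towards `c` from either side, more indices contribute to the supremum. The point
`c` belongs to both sides and sees all of them. -/
theorem unimodalHull_unimodal (c : ℝ) (x w : Fin n → ℝ) : UnimodalAbout c (unimodalHull c x w) := by
  constructor
  · intro y hy z hz hyz
    refine unimodalHull_le _ _ _ _ (unimodalHull_nonneg _ _ _ _) fun i hi => ?_
    refine le_unimodalHull _ _ _ _ _ ?_
    rcases hi with hi | hi
    · exact Or.inl ⟨hi.1.trans hyz, hz⟩
    · have hyc : y = c := le_antisymm hy hi.1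
      have hzc : z = c := le_antisymm hz (hyc ▸ hyz)
      exact Or.inr ⟨hzc.ge, by rw [hzc, ← hyc]; exact hi.2⟩
  · intro y hy z hz hyz
    refine unimodalHull_le _ _ _ _ (unimodalHull_nonneg _ _ _ _) fun i hi => ?_
    refine le_unimodalHull _ _ _ _ _ ?_
    rcases hi with hi | hi
    · have hzc : z = c := le_antisymm hi.2 hz
      have hyc : y = c := le_antisymm (hzc ▸ hyz) hy
      exact Or.inl ⟨by rw [hyc, ← hzc]; exact hi.1, hyc.le⟩
    · exact Or.inr ⟨hy, hyz.trans hi.2⟩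

/-- The discrete shape constraint describes the restrictions of likelihood ratios to the points. -/
theorem image_likelihoodRatios_eq_discreteShape (hM : 0 < M) (hγ : γ ∈ Set.Ioo (0 : ℝ) 1)
    (hpos : ∀ y, 0 < g₀ y) (huni : UnimodalAbout c g₀) (hx : Function.Injective x) :
    (fun (L : ℝ → ℝ) (i : Fin n) => L (x i)) '' likelihoodRatios (shapeClass M γ c g₀) g₀ =
      discreteShape M γ c g₀ x := by
  have hp : 0 ≤ 1 / (1 - γ) := by have := hγ.2; exact div_nonneg zero_le_one (by linarith)
  apply Set.Subset.antisymm
  · rintro _ ⟨_, ⟨f, ⟨hf, hmono, hanti⟩, rfl⟩, rfl⟩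
    have hcancel : ∀ i, f (x i) / g₀ (x i) * g₀ (x i) = f (x i) :=
      fun i => div_mul_cancel₀ _ (hpos _).ne'
    refine ⟨fun i j hij hj => ?_, fun i j hij hi => ?_, fun i => ?_⟩
    · simp only [hcancel]
      have hle := sort_monotone x (i := i) (j := j) (by rw [Fin.le_def]; omega)
      exact hmono (hle.trans hj) hj hle
    · simp only [hcancel]
      have hle := sort_monotone x (i := i) (j := j) (by rw [Fin.le_def]; omega)
      exact hanti hi (le_trans (Set.mem_Ici.1 hi) hle) hle
    · simp only [hcancel]
      exact hf _
  · intro v hv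
    set w : Fin n → ℝ := fun i => v i * g₀ (x i) with hw
    have hcap : ∀ y z, g₀ y ≤ g₀ z → (M * g₀ y) ^ (1 / (1 - γ)) ≤ (M * g₀ z) ^ (1 / (1 - γ)) :=
      fun y z h => Real.rpow_le_rpow (mul_pos hM (hpos _)).le
        (mul_le_mul_of_nonneg_left h hM.le) hp
    refine ⟨fun y => unimodalHull c x w y / g₀ y, ⟨unimodalHull c x w, ⟨fun y => ⟨?_, ?_⟩, ?_⟩, rfl⟩,
      ?_⟩
    · exact unimodalHull_nonneg _ _ _ _
    -- A sample point that contributes at `y` lies on the same side of `c` and at least as far out,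
    -- so by unimodality of `g₀` its cap is at most the cap at `y`.
    · refine unimodalHull_le _ _ _ _ (Real.rpow_nonneg (mul_pos hM (hpos _)).le _) fun i hi => ?_
      refine (hv.2.2 i).2.trans (hcap _ _ ?_)
      rcases hi with hi | hi
      · exact huni.1 (hi.1.trans hi.2) hi.2 hi.1
      · exact huni.2 hi.1 (hi.1.trans hi.2) hi.2
    · exact unimodalHull_unimodal _ _ _
    · funext j
      have hval : unimodalHull c x w (x j) = w j := by
        apply le_antisymm
        · refine unimodalHull_le _ _ _ _ (hv.2.2 j).1 fun i hi => ?_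
          rcases hi with hi | hi
          · exact discreteShape_left hx hv hi.1 hi.2
          · exact discreteShape_right hx hv hi.2 hi.1
        · refine le_unimodalHull _ _ _ _ _ ?_
          rcases le_total (x j) c with h | h
          · exact Or.inl ⟨le_rfl, h⟩
          · exact Or.inr ⟨h, le_rfl⟩
      show unimodalHull c x w (x j) / g₀ (x j) = v j
      rw [hval]
      exact mul_div_cancel_right₀ _ (hpos _).ne'

variable {m k : ℕ}

theorem image_feasibleSet_eq (D : MomentData m k) {𝓛 : Set (ℝ → ℝ)} {S : Set (Fin n → ℝ)}
    (h : (fun (L : ℝ → ℝ) (i : Fin n) => L (x i)) '' 𝓛 = S) :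
    (fun (L : ℝ → ℝ) (i : Fin n) => L (x i)) '' feasibleSet (sampleMean x) D 𝓛 =
      discreteFeasibleSet D x S := by
  subst h
  apply Set.Subset.antisymm
  · rintro _ ⟨L, ⟨hL, hi, he⟩, rfl⟩
    exact ⟨⟨L, hL, rfl⟩, hi, he⟩
  · rintro _ ⟨⟨L, hL, rfl⟩, hi, he⟩
    exact ⟨L, ⟨hL, hi, he⟩, rfl⟩

theorem optimalValue_eq_discreteOptimalValue (D : MomentData m k) {𝓛 : Set (ℝ → ℝ)}
    {S : Set (Fin n → ℝ)} (h : (fun (L : ℝ → ℝ) (i : Fin n) => L (x i)) '' 𝓛 = S) :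
    optimalValue (sampleMean x) D 𝓛 = discreteOptimalValue D x S := by
  unfold optimalValue discreteOptimalValue
  rw [← image_feasibleSet_eq D h, iSup_image]
  rfl

/-! ### The discretized constraints as a polyhedron. -/

/-- The set `S` is the solution set of finitely many linear inequalities. -/
def IsPolyhedron (S : Set (Fin n → ℝ)) : Prop :=
  ∃ (N : ℕ) (A : Matrix (Fin N) (Fin n) ℝ) (b : Fin N → ℝ), S = {v | A *ᵥ v ≤ b}

theorem isPolyhedron_halfspace (a : Fin n → ℝ) (b : ℝ) : IsPolyhedron {v | a ⬝ᵥ v ≤ b} := by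
  refine ⟨1, fun _ => a, fun _ => b, ?_⟩
  ext v
  simp [Pi.le_def, Matrix.mulVec]

theorem isPolyhedron_iInter {ι : Type*} [Finite ι] {S : ι → Set (Fin n → ℝ)}
    (h : ∀ i, IsPolyhedron (S i)) : IsPolyhedron (⋂ i, S i) := by
  choose N A b hS using h
  have := Fintype.ofFinite ι
  let e := Fintype.equivFin (Σ i, Fin (N i))
  refine ⟨_, fun l => A (e.symm l).1 (e.symm l).2, fun l => b (e.symm l).1 (e.symm l).2, ?_⟩
  ext v
  simp only [Set.mem_iInter, hS, Set.mem_ofPred_eq, Pi.le_def]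
  constructor
  · intro hv l
    exact hv _ _
  · intro hv i j
    have := hv (e ⟨i, j⟩)
    simp only [Matrix.mulVec] at this ⊢
    rw [e.symm_apply_apply] at this
    exact this

theorem IsPolyhedron.inter {S T : Set (Fin n → ℝ)} (hS : IsPolyhedron S) (hT : IsPolyhedron T) :
    IsPolyhedron (S ∩ T) := by
  rw [Set.inter_eq_iInter]
  exact isPolyhedron_iInter fun b => by cases b <;> assumption

/-- The side conditions in the shape constraint concern only the sample, not the unknowns: each
inequality is either present or replaced by a system without rows. -/
theorem isPolyhedron_imp {q : Prop} {S : Set (Fin n → ℝ)} (hS : IsPolyhedron S) :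
    IsPolyhedron {v | q → v ∈ S} := by
  by_cases h : q
  · simpa [h] using hS
  · exact ⟨0, 0, 0, by ext v; simp [h]⟩

theorem isPolyhedron_le (a b : Fin n → ℝ) (r : ℝ) : IsPolyhedron {v | a ⬝ᵥ v ≤ b ⬝ᵥ v + r} := by
  convert isPolyhedron_halfspace (a - b) r using 3
  rw [sub_dotProduct, sub_le_iff_le_add, add_comm]

theorem dotProduct_smul_single (i : Fin n) (r : ℝ) (v : Fin n → ℝ) :
    (Pi.single i r : Fin n → ℝ) ⬝ᵥ v = v i * r := by
  rw [single_dotProduct, mul_comm]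

theorem mean_eq_dotProduct (φ : ℝ → ℝ) (x v : Fin n → ℝ) :
    (1 / (n : ℝ)) * ∑ i, φ (x i) * v i = (fun i => (1 / (n : ℝ)) * φ (x i)) ⬝ᵥ v := by
  simp only [dotProduct, Finset.mul_sum, mul_assoc]

theorem isPolyhedron_discreteShape (M γ c : ℝ) (g₀ : ℝ → ℝ) (x : Fin n → ℝ) :
    IsPolyhedron (discreteShape M γ c g₀ x) := by
  have hpair : ∀ i j : Fin n, IsPolyhedron {v : Fin n → ℝ | v i * g₀ (x i) ≤ v j * g₀ (x j)} := by
    intro i j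
    simpa only [dotProduct_smul_single, add_zero] using
      isPolyhedron_le (Pi.single i (g₀ (x i))) (Pi.single j (g₀ (x j))) 0
  have hlow : ∀ i : Fin n, IsPolyhedron {v : Fin n → ℝ | 0 ≤ v i * g₀ (x i)} := by
    intro i
    simpa only [dotProduct_smul_single, add_zero, zero_dotProduct] using
      isPolyhedron_le 0 (Pi.single i (g₀ (x i))) 0
  have hup : ∀ i : Fin n, IsPolyhedron
      {v : Fin n → ℝ | v i * g₀ (x i) ≤ (M * g₀ (x i)) ^ (1 / (1 - γ))} := by
    intro i
    simpa only [dotProduct_smul_single] using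
      isPolyhedron_halfspace (Pi.single i (g₀ (x i))) ((M * g₀ (x i)) ^ (1 / (1 - γ)))
  have h1 := isPolyhedron_iInter fun i : Fin n => isPolyhedron_iInter fun j : Fin n =>
    isPolyhedron_imp (q := (i : ℕ) + 1 = j) (isPolyhedron_imp
      (q := x (Tuple.sort x j) ≤ c) (hpair (Tuple.sort x i) (Tuple.sort x j)))
  have h2 := isPolyhedron_iInter fun i : Fin n => isPolyhedron_iInter fun j : Fin n =>
    isPolyhedron_imp (q := (i : ℕ) + 1 = j) (isPolyhedron_imp
      (q := c ≤ x (Tuple.sort x i)) (hpair (Tuple.sort x j) (Tuple.sort x i)))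
  have h3 := isPolyhedron_iInter fun i => (hlow i).inter (hup i)
  convert h1.inter (h2.inter h3) using 1
  ext v
  simp only [discreteShape, Set.mem_ofPred_eq, Set.mem_inter_iff, Set.mem_iInter]

theorem isLinearProgram_discrete (D : MomentData m k) (M γ c : ℝ) (g₀ : ℝ → ℝ) (x : Fin n → ℝ) :
    IsLinearProgram (discreteObjective D x)
      (discreteFeasibleSet D x (discreteShape M γ c g₀ x)) := by
  refine ⟨⟨_, fun v => mean_eq_dotProduct D.obj x v⟩, ?_⟩
  have h1 := isPolyhedron_iInter fun j =>
    isPolyhedron_halfspace (fun i => (1 / (n : ℝ)) * D.ineq j (x i)) (D.ineqBound j)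
  have h2 := isPolyhedron_iInter fun j =>
    isPolyhedron_halfspace (fun i => (1 / (n : ℝ)) * D.eq j (x i)) (D.eqBound j)
  have h3 := isPolyhedron_iInter fun j =>
    isPolyhedron_halfspace (-fun i => (1 / (n : ℝ)) * D.eq j (x i)) (-D.eqBound j)
  have h := (isPolyhedron_discreteShape M γ c g₀ x).inter (h1.inter (h2.inter h3))
  suffices hS : discreteFeasibleSet D x (discreteShape M γ c g₀ x) = _ by
    rw [hS]; exact h
  ext v
  simp only [discreteFeasibleSet, Set.mem_ofPred_eq, Set.mem_inter_iff, Set.mem_iInter,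
    mean_eq_dotProduct, neg_dotProduct, neg_le_neg_iff, le_antisymm_iff, forall_and]

end Discretization

/-! ### A maximal inequality for weighted empirical processes indexed by half-lines -/

section Signs

/-- The sign `±1` that a Boolean encodes. -/
def boolSign (b : Bool) : ℝ := if b then 1 else -1

theorem boolSign_not (b : Bool) : boolSign (!b) = -boolSign b := by cases b <;> simp [boolSign]

theorem boolSign_sq (b : Bool) : boolSign b ^ 2 = 1 := by cases b <;> simp [boolSign]

variable {ι : Type*} [DecidableEq ι]

/-- Flipping the `i`-th sign is a fixed-point-free involution that preserves `F` and negates the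
other factor, so the terms cancel in pairs. -/
theorem sum_mul_boolSign_eq_zero [Fintype ι] {F : (ι → Bool) → ℝ} {i : ι}
    (hF : ∀ ε β, F (Function.update ε i β) = F ε) : ∑ ε, F ε * boolSign (ε i) = 0 := by
  refine Finset.sum_involution (fun ε _ => Function.update ε i (!ε i)) ?_ ?_ ?_ ?_
  · intro ε _
    simp [hF, boolSign_not]
  · intro ε _ _ h
    have := congrFun h i
    simp at this
  · intro ε _
    exact Finset.mem_univ _
  · intro ε _
    simp

/-- Signed partial sum over the index set `s`. -/
def signedSum (b : ι → ℝ) (s : Finset ι) (ε : ι → Bool) : ℝ := ∑ i ∈ s, boolSign (ε i) * b i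

theorem signedSum_update (b : ι → ℝ) {s : Finset ι} {i : ι} (hi : i ∉ s) (ε : ι → Bool) (β : Bool) :
    signedSum b s (Function.update ε i β) = signedSum b s ε := by
  refine Finset.sum_congr rfl fun j hj => ?_
  rw [Function.update_of_ne (fun h : j = i => hi (h ▸ hj))]

theorem signedSum_insert (b : ι → ℝ) {s : Finset ι} {i : ι} (hi : i ∉ s) (ε : ι → Bool) :
    signedSum b (insert i s) ε = signedSum b s ε + boolSign (ε i) * b i := by
  rw [signedSum, Finset.sum_insert hi, add_comm]
  rfl

variable [Fintype ι]

/-- Distinct signs are orthogonal, so the cross terms vanish as each index is added. -/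
theorem sum_signedSum_sq (b : ι → ℝ) (s : Finset ι) :
    ∑ ε, signedSum b s ε ^ 2 = Fintype.card (ι → Bool) * ∑ i ∈ s, b i ^ 2 := by
  induction s using Finset.induction_on with
  | empty => simp [signedSum]
  | insert i s hi ih =>
    have h0 := sum_mul_boolSign_eq_zero (signedSum_update b hi)
    have h1 : ∀ ε : ι → Bool, signedSum b (insert i s) ε ^ 2 =
        signedSum b s ε ^ 2 + (2 * b i) * (signedSum b s ε * boolSign (ε i)) + b i ^ 2 := by
      intro ε
      rw [signedSum_insert b hi]
      linear_combination b i ^ 2 * boolSign_sq (ε i)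
    simp only [h1, Finset.sum_add_distrib, ← Finset.mul_sum, h0, ih, Finset.sum_insert hi,
      Finset.sum_const, Finset.card_univ, nsmul_eq_mul]
    ring

/-- Doob's maximal inequality for random signs, in the form of a running maximum `Y` for which
`Y² - 2 Y S` has nonpositive mean. -/
theorem exists_running_max (r b : ι → ℝ) (s : Finset ι) :
    ∃ Y : (ι → Bool) → ℝ, (∀ ε, 0 ≤ Y ε) ∧
      (∀ ε i β, i ∉ s → Y (Function.update ε i β) = Y ε) ∧
      (∀ ε a, signedSum b (s.filter fun i => r i ≤ a) ε ≤ Y ε) ∧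
      ∑ ε, (Y ε ^ 2 - 2 * Y ε * signedSum b s ε) ≤ 0 := by
  -- Indices enter in increasing order of `r`, so a half-line that contains the new index contains
  -- all of `s`, and the full sum is the only new partial sum.
  induction s using Finset.induction_on_max_value r with
  | empty => exact ⟨fun _ => 0, by simp [signedSum]⟩
  | insert i s hi hmax ih =>
    obtain ⟨Y, hY0, hYinv, hYmax, hYsum⟩ := ih
    refine ⟨fun ε => max (Y ε) (signedSum b (insert i s) ε), fun ε => le_max_of_le_left (hY0 ε),
      fun ε j β hj => ?_, fun ε a => ?_, ?_⟩
    · simp only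
      rw [signedSum_update b hj, hYinv ε j β fun h => hj (Finset.mem_insert_of_mem h)]
    · by_cases hia : r i ≤ a
      · refine le_max_of_le_right (le_of_eq ?_)
        rw [Finset.filter_true_of_mem]
        intro j hj
        rcases Finset.mem_insert.1 hj with rfl | hj
        · exact hia
        · exact (hmax j hj).trans hia
      · rw [Finset.filter_insert, if_neg hia]
        exact le_max_of_le_left (hYmax ε a)
    -- For a given sum `S`, `t ^ 2 - 2 * t * S` is least at `t = S`, so raising the maximum to the
    -- new sum does not increase it. What remains is a cross term of mean zero, because `Y` does not
    -- depend on sign `i`.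
    · have h0 := sum_mul_boolSign_eq_zero (F := Y) (i := i) fun ε β => hYinv ε i β hi
      calc ∑ ε, (max (Y ε) (signedSum b (insert i s) ε) ^ 2 -
              2 * max (Y ε) (signedSum b (insert i s) ε) * signedSum b (insert i s) ε)
          ≤ ∑ ε, ((Y ε ^ 2 - 2 * Y ε * signedSum b s ε) -
              (2 * b i) * (Y ε * boolSign (ε i))) := by
            refine Finset.sum_le_sum fun ε _ => ?_
            rw [signedSum_insert b hi]
            rcases max_choice (Y ε) (signedSum b s ε + boolSign (ε i) * b i) with h | h <;> rw [h]
            · exact le_of_eq (by ring)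
            · nlinarith [sq_nonneg (Y ε - (signedSum b s ε + boolSign (ε i) * b i))]
        _ ≤ 0 := by
            rw [Finset.sum_sub_distrib, ← Finset.mul_sum, h0]
            linarith

/-- Ranking by `-r` turns upper half-lines into initial segments. Doob's constant `4` comes from `Y²
≤ 2 (Y² - 2 Y S) + 4 S²`, that is `0 ≤ (Y - 2 S)²`. -/
theorem exists_upper_envelope (r b : ι → ℝ) :
    ∃ Y : (ι → Bool) → ℝ, (∀ ε, 0 ≤ Y ε) ∧
      (∀ ε a, ∑ i, boolSign (ε i) * (if a ≤ r i then b i else 0) ≤ Y ε) ∧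
      ∑ ε, Y ε ^ 2 ≤ 4 * (Fintype.card (ι → Bool) * ∑ i, b i ^ 2) := by
  obtain ⟨Y, hY0, -, hYmax, hYsum⟩ := exists_running_max (fun i => -r i) b Finset.univ
  refine ⟨Y, hY0, fun ε a => ?_, ?_⟩
  · refine le_of_eq_of_le ?_ (hYmax ε (-a))
    simp only [signedSum, neg_le_neg_iff, Finset.sum_filter, mul_ite, mul_zero]
  · rw [← sum_signedSum_sq, Finset.mul_sum]
    calc ∑ ε, Y ε ^ 2 ≤ ∑ ε, (2 * (Y ε ^ 2 - 2 * Y ε * signedSum b Finset.univ ε) +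
          4 * signedSum b Finset.univ ε ^ 2) := by
          refine Finset.sum_le_sum fun ε _ => ?_
          nlinarith [sq_nonneg (Y ε - 2 * signedSum b Finset.univ ε)]
      _ ≤ _ := by
          rw [Finset.sum_add_distrib, ← Finset.mul_sum]
          linarith

/-- Maximal inequality for random signs over all half-lines. -/
theorem exists_envelope (r b : ι → ℝ) :
    ∃ R : (ι → Bool) → ℝ,
      (∀ ε a, |∑ i, boolSign (ε i) * (if a ≤ r i then b i else 0)| ≤ R ε) ∧
      ∑ ε, R ε ≤ Fintype.card (ι → Bool) * √(8 * ∑ i, b i ^ 2) := by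
  obtain ⟨Y, hY0, hY, hYs⟩ := exists_upper_envelope r b
  obtain ⟨Y', hY0', hY', hYs'⟩ := exists_upper_envelope r fun i => -b i
  -- The root dominates the envelopes for `b` and for `-b`. Its mean is bounded by Cauchy–Schwarz,
  -- with `8 = 4 + 4`.
  refine ⟨fun ε => √(Y ε ^ 2 + Y' ε ^ 2), fun ε a => ?_, ?_⟩
  · have h1 := hY ε a
    have h2 : -∑ i, boolSign (ε i) * (if a ≤ r i then b i else 0) ≤ Y' ε := by
      refine le_of_eq_of_le ?_ (hY' ε a)
      rw [← Finset.sum_neg_distrib]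
      refine Finset.sum_congr rfl fun i _ => ?_
      split_ifs <;> ring
    rw [abs_le']
    exact ⟨h1.trans (Real.le_sqrt_of_sq_le (by nlinarith [sq_nonneg (Y' ε)])),
      h2.trans (Real.le_sqrt_of_sq_le (by nlinarith [sq_nonneg (Y ε)]))⟩
  · have hcs := Finset.sum_mul_sq_le_sq_mul_sq Finset.univ (fun _ : ι → Bool => (1 : ℝ))
      fun ε => √(Y ε ^ 2 + Y' ε ^ 2)
    have h1 : ∀ ε, √(Y ε ^ 2 + Y' ε ^ 2) ^ 2 = Y ε ^ 2 + Y' ε ^ 2 :=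
      fun ε => Real.sq_sqrt (by positivity)
    simp only [one_mul, one_pow, h1, Finset.sum_const, Finset.card_univ, nsmul_eq_mul, mul_one,
      Finset.sum_add_distrib] at hcs
    simp only [neg_sq] at hYs'
    refine abs_le_of_sq_le_sq' ?_ (by positivity) |>.2
    rw [mul_pow, Real.sq_sqrt (by positivity)]
    refine hcs.trans ?_
    have hN : (0 : ℝ) ≤ Fintype.card (ι → Bool) := Nat.cast_nonneg _
    nlinarith [mul_le_mul_of_nonneg_left (add_le_add hYs hYs') hN]

end Signs

/-! ### Symmetrization, and the mean of the supremum over half-lines. -/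

section Symmetrization

/-- The functions `h · 1{r ≥ q}` for rational `q`. -/
noncomputable def truncations {E : Type*} (r h : E → ℝ) (q : ℚ) (y : E) : ℝ := if (q : ℝ) ≤ r y then h y else 0

theorem abs_truncations_le {E : Type*} (r h : E → ℝ) (q : ℚ) (y : E) : |truncations r h q y| ≤ |h y| := by
  unfold truncations
  split_ifs <;> simp

theorem measurable_truncations {E : Type*} [MeasurableSpace E] {r h : E → ℝ} (hr : Measurable r) (hh : Measurable h) (q : ℚ) :
    Measurable (truncations r h q) :=
  Measurable.ite (measurableSet_le measurable_const hr) hh measurable_const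

variable {ι κ E : Type*} [Fintype ι] [Countable κ] [MeasurableSpace E] {μ : Measure E}

/-- The supremum of the centred sums `∑ (ξ_q(x_i) - ∫ ξ_q dμ)` over the index `q`. -/
noncomputable def centredSup (μ : Measure E) (ξ : κ → E → ℝ) (x : ι → E) : ℝ≥0∞ :=
  ⨆ q, ‖∑ i, (ξ q (x i) - ∫ y, ξ q y ∂μ)‖ₑ

theorem measurable_centredSup {ξ : κ → E → ℝ} (hξ : ∀ q, Measurable (ξ q)) :
    Measurable (centredSup (ι := ι) μ ξ) :=
  Measurable.iSup fun q => (Finset.measurable_sum _ fun i _ =>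
    ((hξ q).comp (measurable_pi_apply i)).sub_const _).enorm

variable [IsProbabilityMeasure μ]

theorem integral_pi_eval {f : E → ℝ} (hf : Measurable f) (i : ι) :
    ∫ x : ι → E, f (x i) ∂(Measure.pi fun _ => μ) = ∫ y, f y ∂μ := by
  have h := measurePreserving_eval (fun _ : ι => μ) i
  conv_rhs => rw [← h.map_eq]
  exact (integral_map h.measurable.aemeasurable hf.aestronglyMeasurable).symm

theorem integrable_pi_eval {f : E → ℝ} (hf : Integrable f μ) (i : ι) :
    Integrable (fun x : ι → E => f (x i)) (Measure.pi fun _ => μ) :=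
  (measurePreserving_eval (fun _ : ι => μ) i).integrable_comp_of_integrable hf

/-- Symmetrization by an independent copy and random signs. -/
theorem lintegral_centredSup_le {ξ : κ → E → ℝ} (hξ : ∀ q, Measurable (ξ q))
    (hint : ∀ q, Integrable (ξ q) μ) (ε : ι → Bool) :
    ∫⁻ x : ι → E, centredSup μ ξ x ∂(Measure.pi fun _ => μ) ≤
      2 * ∫⁻ x : ι → E, ⨆ q, ‖∑ i, boolSign (ε i) * ξ q (x i)‖ₑ ∂(Measure.pi fun _ => μ) := by
  classical
  set ν : Measure (ι → E) := Measure.pi fun _ => μ with hν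
  set R : (ι → E) → ℝ≥0∞ := fun x => ⨆ q, ‖∑ i, boolSign (ε i) * ξ q (x i)‖ₑ with hR
  have hRm : Measurable R := Measurable.iSup fun q => (Finset.measurable_sum _ fun i _ =>
    ((hξ q).comp (measurable_pi_apply i)).const_mul _).enorm
  set F : (ι → E) × (ι → E) → ℝ≥0∞ := fun z => ⨆ q, ‖∑ i, (ξ q (z.1 i) - ξ q (z.2 i))‖ₑ with hF
  have hFm : Measurable F := Measurable.iSup fun q => (Finset.measurable_sum _ fun i _ =>
    ((hξ q).comp ((measurable_pi_apply i).comp measurable_fst)).sub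
      ((hξ q).comp ((measurable_pi_apply i).comp measurable_snd))).enorm
  have h1 : ∀ x, centredSup μ ξ x ≤ ∫⁻ y, F (x, y) ∂ν := by
    intro x
    refine iSup_le fun q => ?_
    have hI : ∀ i, Integrable (fun y : ι → E => ξ q (x i) - ξ q (y i)) ν :=
      fun i => (integrable_const _).sub (integrable_pi_eval (hint q) i)
    have : ∑ i, (ξ q (x i) - ∫ y, ξ q y ∂μ) = ∫ y, ∑ i, (ξ q (x i) - ξ q (y i)) ∂ν := by
      rw [integral_finsetSum _ fun i _ => hI i]
      refine Finset.sum_congr rfl fun i _ => ?_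
      rw [integral_sub (integrable_const _) (integrable_pi_eval (hint q) i),
        integral_pi_eval (hξ q) i]
      simp
    rw [this]
    refine (enorm_integral_le_lintegral_enorm _).trans (lintegral_mono fun y => ?_)
    exact le_iSup (fun q => ‖∑ i, (ξ q (x i) - ξ q (y i))‖ₑ) q
  have harr := measurePreserving_arrowProdEquivProdArrow E E ι (fun _ => μ) (fun _ => μ)
  -- Swapping the two copies at the indices with sign `-1` preserves the product law and turns the
  -- differences into signed differences.
  let T : (ι → E × E) → (ι → E × E) := fun z i => if ε i then z i else (z i).swap
  have hT : MeasurePreserving T (Measure.pi fun _ => μ.prod μ) (Measure.pi fun _ => μ.prod μ) := by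
    refine measurePreserving_pi (f := fun i (z : E × E) => if ε i then z else z.swap) _ _ fun i => ?_
    cases ε i
    · simpa using Measure.measurePreserving_swap (μ := μ) (ν := μ)
    · simpa using! MeasurePreserving.id (μ.prod μ)
  have hle : ∀ z : ι → E × E, F (MeasurableEquiv.arrowProdEquivProdArrow E E ι (T z)) ≤
      R (fun i => (z i).1) + R (fun i => (z i).2) := by
    intro z
    refine iSup_le fun q => ?_
    have : ∑ i, (ξ q ((T z i).1) - ξ q ((T z i).2)) =
        ∑ i, boolSign (ε i) * ξ q (z i).1 - ∑ i, boolSign (ε i) * ξ q (z i).2 := by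
      rw [← Finset.sum_sub_distrib]
      refine Finset.sum_congr rfl fun i _ => ?_
      cases hε : ε i
      · simp [T, hε, boolSign]
        ring
      · simp [T, hε, boolSign]
    show ‖∑ i, (ξ q ((T z i).1) - ξ q ((T z i).2))‖ₑ ≤ _
    rw [this]
    exact enorm_sub_le.trans (add_le_add
      (le_iSup (fun q => ‖∑ i, boolSign (ε i) * ξ q (z i).1‖ₑ) q)
      (le_iSup (fun q => ‖∑ i, boolSign (ε i) * ξ q (z i).2‖ₑ) q))
  calc ∫⁻ x, centredSup μ ξ x ∂ν ≤ ∫⁻ x, ∫⁻ y, F (x, y) ∂ν ∂ν := lintegral_mono h1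
    _ = ∫⁻ z, F z ∂(ν.prod ν) := (lintegral_prod _ hFm.aemeasurable).symm
    _ = ∫⁻ z, F (MeasurableEquiv.arrowProdEquivProdArrow E E ι z)
          ∂(Measure.pi fun _ => μ.prod μ) := (harr.lintegral_comp hFm).symm
    _ = ∫⁻ z, F (MeasurableEquiv.arrowProdEquivProdArrow E E ι (T z))
          ∂(Measure.pi fun _ => μ.prod μ) :=
        (hT.lintegral_comp (hFm.comp harr.measurable)).symm
    _ ≤ ∫⁻ z, (R (fun i => (z i).1) + R (fun i => (z i).2)) ∂(Measure.pi fun _ => μ.prod μ) :=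
        lintegral_mono hle
    _ = ∫⁻ z, (R z.1 + R z.2) ∂(ν.prod ν) :=
        harr.lintegral_comp (f := fun z => R z.1 + R z.2)
          ((hRm.comp measurable_fst).add (hRm.comp measurable_snd))
    _ = 2 * ∫⁻ x, R x ∂ν := by
        rw [two_mul]
        refine (lintegral_add_left (hRm.comp measurable_fst) _).trans ?_
        congr 1
        · exact measurePreserving_fst.lintegral_comp hRm
        · exact measurePreserving_snd.lintegral_comp hRm

/-- The maximal inequality: the weighted empirical process over half-lines is of order
`√(n ∫ h² dμ)` in mean, uniformly over the half-lines. -/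
theorem lintegral_centredSup_truncations_le {r h : E → ℝ} (hr : Measurable r) (hh : Measurable h)
    (h2 : MemLp h 2 μ) {B : ℝ} (hB : 0 < B)
    (hhB : 8 * (Fintype.card ι * ∫ y, h y ^ 2 ∂μ) ≤ B ^ 2) :
    ∫⁻ x : ι → E, centredSup μ (truncations r h) x ∂(Measure.pi fun _ => μ) ≤
      ENNReal.ofReal (2 * B) := by
  classical
  set ν : Measure (ι → E) := Measure.pi fun _ => μ with hν
  have hint : Integrable h μ := h2.integrable (by norm_num)
  have hξm := measurable_truncations hr hh
  have hξi : ∀ q, Integrable (truncations r h q) μ := fun q =>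
    hint.mono (hξm q).aestronglyMeasurable (ae_of_all _ fun y => abs_truncations_le r h q y)
  set N := Fintype.card (ι → Bool) with hN
  have hNpos : 0 < N := Fintype.card_pos
  set I := ∫⁻ x : ι → E, centredSup μ (truncations r h) x ∂ν
  have hI2 : Integrable (fun x : ι → E => ∑ i, h (x i) ^ 2) ν :=
    integrable_finsetSum _ fun i _ => integrable_pi_eval h2.integrable_sq i
  -- Symmetrization holds for each sign pattern, so it may be summed over all of them. For a fixed
  -- sample the sum over patterns is then controlled by `exists_envelope`.
  have hsum : (N : ℝ≥0∞) * I ≤ N * ENNReal.ofReal (2 * B) := by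
    calc (N : ℝ≥0∞) * I = ∑ _ε : ι → Bool, I := by simp [hN]
      _ ≤ ∑ ε : ι → Bool,
            2 * ∫⁻ x : ι → E, ⨆ q, ‖∑ i, boolSign (ε i) * truncations r h q (x i)‖ₑ ∂ν :=
          Finset.sum_le_sum fun ε _ => lintegral_centredSup_le hξm hξi ε
      _ = 2 * ∫⁻ x : ι → E, ∑ ε : ι → Bool,
            ⨆ q, ‖∑ i, boolSign (ε i) * truncations r h q (x i)‖ₑ ∂ν := by
          rw [← Finset.mul_sum, lintegral_finsetSum]
          intro ε _
          exact Measurable.iSup fun q => (Finset.measurable_sum _ fun i _ =>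
            ((hξm q).comp (measurable_pi_apply i)).const_mul _).enorm
      -- The bound `√g ≤ (g / B + B) / 2` stands in for Jensen's inequality: it is linear in the sum
      -- of squares and integrates exactly.
      _ ≤ 2 * ∫⁻ x : ι → E, ENNReal.ofReal (N * ((8 * ∑ i, h (x i) ^ 2) / B + B) / 2) ∂ν := by
          gcongr with x
          obtain ⟨R, hR, hRs⟩ := exists_envelope (fun i => r (x i)) fun i => h (x i)
          have hR0 : ∀ ε, 0 ≤ R ε := fun ε => (abs_nonneg _).trans (hR ε 0)
          calc ∑ ε : ι → Bool, ⨆ q, ‖∑ i, boolSign (ε i) * truncations r h q (x i)‖ₑ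
              ≤ ∑ ε, ENNReal.ofReal (R ε) := by
                refine Finset.sum_le_sum fun ε _ => iSup_le fun q => ?_
                rw [Real.enorm_eq_ofReal_abs]
                exact ENNReal.ofReal_le_ofReal (hR ε q)
            _ = ENNReal.ofReal (∑ ε, R ε) := (ENNReal.ofReal_sum_of_nonneg fun ε _ => hR0 ε).symm
            _ ≤ _ := by
                refine ENNReal.ofReal_le_ofReal (hRs.trans ?_)
                rw [mul_div_assoc]
                gcongr
                set g := 8 * ∑ i, h (x i) ^ 2 with hg
                have hg0 : 0 ≤ g := by positivity
                have hs := Real.sq_sqrt hg0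
                have : g / B * B = g := div_mul_cancel₀ _ hB.ne'
                rw [le_div_iff₀ two_pos]
                have h3 : 0 ≤ (√g - B) ^ 2 / B := by positivity
                have h4 : (√g - B) ^ 2 / B = g / B + B - √g * 2 := by
                  rw [sub_sq, hs]; field_simp; ring
                linarith
      _ = 2 * ENNReal.ofReal (∫ x : ι → E, (N * ((8 * ∑ i, h (x i) ^ 2) / B + B) / 2) ∂ν) := by
          rw [ofReal_integral_eq_lintegral_ofReal]
          · exact ((((hI2.const_mul 8).div_const B).add (integrable_const B)).const_mul
              (N : ℝ)).div_const 2
          · exact ae_of_all _ fun x => by positivity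
      _ ≤ 2 * ENNReal.ofReal (N * B) := by
          gcongr
          rw [integral_div, integral_const_mul,
            integral_add ((hI2.const_mul 8).div_const B) (integrable_const B), integral_div,
            integral_const_mul, integral_finsetSum _ fun i _ => integrable_pi_eval
              h2.integrable_sq i]
          simp only [integral_pi_eval (hh.pow_const 2), Finset.sum_const, Finset.card_univ,
            nsmul_eq_mul, integral_const, probReal_univ, one_smul]
          have h5 : 8 * (Fintype.card ι * ∫ y, h y ^ 2 ∂μ) / B ≤ B := by
            rw [div_le_iff₀ hB, ← sq]; exact hhB
          rw [mul_div_assoc]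
          gcongr
          linarith
      _ = N * ENNReal.ofReal (2 * B) := by
          rw [ENNReal.ofReal_mul (Nat.cast_nonneg _), ENNReal.ofReal_mul zero_le_two,
            ENNReal.ofReal_natCast, ENNReal.ofReal_ofNat]
          ring
  exact (ENNReal.mul_le_mul_iff_right (by exact_mod_cast hNpos.ne') (ENNReal.natCast_ne_top _)).1 hsum

end Symmetrization

/-! ### From half-lines to unimodal functions -/

section Monotone

/-- The indicator of an upper set of reals is a pointwise limit of indicators of rational
half-lines. -/
theorem exists_rat_seq_of_isUpperSet {U : Set ℝ} (hU : IsUpperSet U) :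
    ∃ q : ℕ → ℚ, ∀ y : ℝ, ∀ᶠ k in atTop, ((q k : ℝ) ≤ y ↔ y ∈ U) := by
  have hlim : ∀ ε : ℝ, 0 < ε → ∀ᶠ k : ℕ in atTop, 1 / ((k : ℝ) + 1) < ε := fun ε hε =>
    tendsto_one_div_add_atTop_nhds_zero_nat.eventually_lt_const hε
  rcases U.eq_empty_or_nonempty with rfl | hne
  · refine ⟨fun k => k, fun y => ?_⟩
    filter_upwards [tendsto_natCast_atTop_atTop.eventually_gt_atTop y] with k hk
    simpa using hk
  by_cases huniv : U = Set.univ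
  · subst huniv
    refine ⟨fun k => -k, fun y => ?_⟩
    filter_upwards [tendsto_natCast_atTop_atTop.eventually_gt_atTop (-y)] with k hk
    simp only [Rat.cast_neg, Rat.cast_natCast, Set.mem_univ, iff_true]
    linarith
  obtain ⟨z, hz⟩ := (Set.ne_univ_iff_exists_notMem U).1 huniv
  have hbdd : BddBelow U := ⟨z, fun y hy => by
    by_contra h
    exact hz (hU (not_le.1 h).le hy)⟩
  have hlt : ∀ y, sInf U < y → y ∈ U := fun y hy => by
    obtain ⟨w, hw, hwy⟩ := (csInf_lt_iff hbdd hne).1 hy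
    exact hU hwy.le hw
  have hge : ∀ y ∈ U, sInf U ≤ y := fun y hy => csInf_le hbdd hy
  -- Rational thresholds approach the infimum from below if it belongs to `U`, and from above
  -- otherwise.
  by_cases ha : sInf U ∈ U
  · choose q hq using fun k : ℕ => exists_rat_btwn
      (show sInf U - 1 / ((k : ℝ) + 1) < sInf U by
        have : 0 < 1 / ((k : ℝ) + 1) := by positivity
        linarith)
    refine ⟨q, fun y => ?_⟩
    rcases lt_or_ge y (sInf U) with hy | hy
    · filter_upwards [hlim _ (sub_pos.2 hy)] with k hk
      refine ⟨fun h => ?_, fun h => absurd (hge y h) (not_le.2 hy)⟩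
      linarith [(hq k).1]
    · exact Eventually.of_forall fun k => ⟨fun _ => hU hy ha, fun _ => (hq k).2.le.trans hy⟩
  · choose q hq using fun k : ℕ => exists_rat_btwn
      (show sInf U < sInf U + 1 / ((k : ℝ) + 1) by
        have : 0 < 1 / ((k : ℝ) + 1) := by positivity
        linarith)
    refine ⟨q, fun y => ?_⟩
    rcases le_or_gt y (sInf U) with hy | hy
    · refine Eventually.of_forall fun k => ⟨fun h => ?_, fun h => ?_⟩
      · linarith [(hq k).1]
      · exact absurd ((le_antisymm hy (hge y h)) ▸ h) ha
    · filter_upwards [hlim _ (sub_pos.2 hy)] with k hk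
      exact ⟨fun _ => hlt y hy, fun _ => by linarith [(hq k).2]⟩

variable {ι E : Type*} [Fintype ι] [MeasurableSpace E] {μ : Measure E}

/-- The centred sum `∑ (φ(x_i) - ∫ φ dμ)`. -/
noncomputable def centredSum (μ : Measure E) (φ : E → ℝ) (x : ι → E) : ℝ :=
  ∑ i, (φ (x i) - ∫ y, φ y ∂μ)

/-- Dominated convergence for centred sums. -/
theorem tendsto_centredSum {F : ℕ → E → ℝ} {f h : E → ℝ} (hF : ∀ k, AEStronglyMeasurable (F k) μ)
    (hh : Integrable h μ) (hbound : ∀ k y, |F k y| ≤ |h y|)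
    (hlim : ∀ y, Tendsto (fun k => F k y) atTop (𝓝 (f y))) (x : ι → E) :
    Tendsto (fun k => centredSum μ (F k) x) atTop (𝓝 (centredSum μ f x)) := by
  refine tendsto_finsetSum _ fun i _ => (hlim _).sub ?_
  exact tendsto_integral_of_dominated_convergence (fun y => |h y|) hF hh.abs
    (fun k => ae_of_all _ fun y => hbound k y) (ae_of_all _ hlim)

/-- Dominated convergence extends the countable supremum over rational thresholds to all half-lines,
open or closed. -/
theorem enorm_centredSum_indicator_le {r h : E → ℝ} (hr : Measurable r) (hh : Measurable h)
    (hint : Integrable h μ) {U : Set ℝ} (hU : IsUpperSet U) (x : ι → E) :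
    ‖centredSum μ ((r ⁻¹' U).indicator h) x‖ₑ ≤ centredSup μ (truncations r h) x := by
  obtain ⟨q, hq⟩ := exists_rat_seq_of_isUpperSet hU
  have hlim := tendsto_centredSum (μ := μ) (F := fun k => truncations r h (q k))
    (f := (r ⁻¹' U).indicator h)
    (fun k => (measurable_truncations hr hh (q k)).aestronglyMeasurable) hint
    (fun k y => abs_truncations_le r h (q k) y) (fun y => by
      refine tendsto_const_nhds.congr' ?_
      filter_upwards [hq (r y)] with k hk
      by_cases hy : r y ∈ U
      · rw [Set.indicator_of_mem (by exact hy), truncations, if_pos (hk.2 hy)]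
      · rw [Set.indicator_of_notMem (by exact hy), truncations, if_neg fun h' => hy (hk.1 h')]) x
  refine le_of_tendsto hlim.enorm (Eventually.of_forall fun k => ?_)
  exact le_iSup (fun q => ‖∑ i, (truncations r h q (x i) - ∫ y, truncations r h q y ∂μ)‖ₑ) (q k)

/-- Counting the levels `1 / (N + 1), …, 1` that `t` reaches gives the staircase approximation of
`t` by an average of indicators. -/
theorem natCard_levels {t : ℝ} (ht0 : 0 ≤ t) (ht1 : t ≤ 1) (N : ℕ) :
    ((Finset.range (N + 1)).filter fun j : ℕ => ((j : ℝ) + 1) / (N + 1) ≤ t).card =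
      ⌊t * ((N + 1 : ℕ) : ℝ)⌋₊ := by
  have hN : (0 : ℝ) < N + 1 := by positivity
  have hfl : ⌊t * ((N + 1 : ℕ) : ℝ)⌋₊ ≤ N + 1 := by
    refine Nat.floor_le_of_le ?_
    push_cast
    nlinarith
  have : (Finset.range (N + 1)).filter (fun j : ℕ => ((j : ℝ) + 1) / (N + 1) ≤ t) =
      Finset.range ⌊t * ((N + 1 : ℕ) : ℝ)⌋₊ := by
    ext j
    simp only [Finset.mem_filter, Finset.mem_range]
    rw [div_le_iff₀ hN, ← Nat.succ_le_iff (m := j) (n := ⌊t * ((N + 1 : ℕ) : ℝ)⌋₊),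
      Nat.le_floor_iff (by positivity)]
    push_cast
    refine ⟨fun h => h.2, fun h => ⟨?_, h⟩⟩
    have : ((j + 1 : ℕ) : ℝ) ≤ t * ((N + 1 : ℕ) : ℝ) := by push_cast; exact h
    have := (Nat.le_floor this).trans hfl
    omega
  rw [this, Finset.card_range]

/-- A function with values in `[0, 1]` that is monotone with respect to the ranking `r` on the
support of `h` is a mixture of indicators of half-lines, so its centred sum weighted by `h` is
bounded by the supremum over half-lines. -/
theorem enorm_centredSum_mul_le {r h f : E → ℝ} (hr : Measurable r) (hh : Measurable h)
    (hint : Integrable h μ) {S : Set E} (hS : ∀ y ∉ S, h y = 0)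
    (hf : ∀ y ∈ S, 0 ≤ f y ∧ f y ≤ 1) (hmono : ∀ y ∈ S, ∀ z ∈ S, r y ≤ r z → f y ≤ f z)
    (x : ι → E) :
    ‖centredSum μ (fun y => h y * f y) x‖ₑ ≤ centredSup μ (truncations r h) x := by
  -- The upper set of ranks generated by the points where `f` reaches level `(j + 1) / (N + 1)`. By
  -- monotonicity its preimage meets `S` exactly in that superlevel set of `f`.
  let U : ℕ → ℕ → Set ℝ := fun N j => {t | ∃ y ∈ S, r y ≤ t ∧ ((j : ℝ) + 1) / (N + 1) ≤ f y}
  have hU : ∀ N j, IsUpperSet (U N j) := by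
    rintro N j s t hst ⟨y, hy, hys, hyf⟩
    exact ⟨y, hy, hys.trans hst, hyf⟩
  have hUmem : ∀ N j, ∀ y ∈ S, r y ∈ U N j ↔ ((j : ℝ) + 1) / (N + 1) ≤ f y := by
    intro N j y hy
    constructor
    · rintro ⟨z, hz, hzy, hzf⟩
      exact hzf.trans (hmono z hz y hy hzy)
    · exact fun h' => ⟨y, hy, le_rfl, h'⟩
  have hUmeas : ∀ N j, MeasurableSet (r ⁻¹' U N j) := fun N j =>
    hr (hU N j).ordConnected.measurableSet
  let F : ℕ → E → ℝ := fun N y =>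
    (1 / ((N + 1 : ℕ) : ℝ)) * ∑ j ∈ Finset.range (N + 1), (r ⁻¹' U N j).indicator h y
  have hFval : ∀ N, ∀ y ∈ S, F N y = h y * (⌊f y * ((N + 1 : ℕ) : ℝ)⌋₊ / ((N + 1 : ℕ) : ℝ)) := by
    intro N y hy
    have h1 : ∀ j, (r ⁻¹' U N j).indicator h y =
        if ((j : ℝ) + 1) / (N + 1) ≤ f y then h y else 0 := by
      intro j
      classical
      rw [Set.indicator_apply]
      exact if_congr (hUmem N j y hy) rfl rfl
    simp only [F, h1]
    rw [← Finset.sum_filter, Finset.sum_const, natCard_levels (hf y hy).1 (hf y hy).2,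
      nsmul_eq_mul]
    ring
  have hFzero : ∀ N, ∀ y ∉ S, F N y = 0 := by
    intro N y hy
    have h1 : ∀ j, (r ⁻¹' U N j).indicator h y = 0 := fun j =>
      Set.indicator_apply_eq_zero.2 fun _ => hS y hy
    simp [F, h1]
  have hbound : ∀ N y, |F N y| ≤ |h y| := by
    intro N y
    by_cases hy : y ∈ S
    · rw [hFval N y hy, abs_mul]
      refine mul_le_of_le_one_right (abs_nonneg _) ?_
      have hN : (0 : ℝ) < ((N + 1 : ℕ) : ℝ) := by positivity
      rw [abs_of_nonneg (by positivity), div_le_one hN]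
      refine (Nat.floor_le (mul_nonneg (hf y hy).1 hN.le)).trans ?_
      exact mul_le_of_le_one_left hN.le (hf y hy).2
    · rw [hFzero N y hy]
      simp
  have hFm : ∀ N, Measurable (F N) := fun N =>
    (Finset.measurable_sum _ fun j _ => hh.indicator (hUmeas N j)).const_mul _
  have hlim : ∀ y, Tendsto (fun N => F N y) atTop (𝓝 (h y * f y)) := by
    intro y
    by_cases hy : y ∈ S
    · simp only [hFval _ y hy]
      refine Tendsto.const_mul _ ?_
      exact (tendsto_nat_floor_mul_div_atTop (hf y hy).1).comp
        (tendsto_natCast_atTop_atTop.comp (tendsto_add_atTop_nat 1))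
    · simp only [hFzero _ y hy, hS y hy, zero_mul]
      exact tendsto_const_nhds
  have hconv := tendsto_centredSum (μ := μ) (fun N => (hFm N).aestronglyMeasurable) hint hbound hlim x
  refine le_of_tendsto hconv.enorm (Eventually.of_forall fun N => ?_)
  by_cases htop : centredSup μ (truncations r h) x = ⊤
  · rw [htop]
    exact le_top
  have hj : ∀ j, |centredSum μ ((r ⁻¹' U N j).indicator h) x| ≤
      (centredSup μ (truncations r h) x).toReal := by
    intro j
    have := enorm_centredSum_indicator_le hr hh hint (hU N j) x
    rw [Real.enorm_eq_ofReal_abs] at this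
    exact (ENNReal.ofReal_le_iff_le_toReal htop).1 this
  have hsplit : centredSum μ (F N) x = (1 / ((N + 1 : ℕ) : ℝ)) *
      ∑ j ∈ Finset.range (N + 1), centredSum μ ((r ⁻¹' U N j).indicator h) x := by
    have h1 : ∫ y, F N y ∂μ = (1 / ((N + 1 : ℕ) : ℝ)) *
        ∑ j ∈ Finset.range (N + 1), ∫ y, (r ⁻¹' U N j).indicator h y ∂μ := by
      rw [integral_const_mul, integral_finsetSum _ fun j _ => hint.indicator (hUmeas N j)]
    simp only [centredSum, h1]
    conv_rhs => rw [Finset.sum_comm, Finset.mul_sum]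
    refine Finset.sum_congr rfl fun i _ => ?_
    rw [Finset.sum_sub_distrib, mul_sub]
  rw [Real.enorm_eq_ofReal_abs, ENNReal.ofReal_le_iff_le_toReal htop, hsplit, abs_mul,
    abs_of_nonneg (by positivity)]
  have hN : (0 : ℝ) < ((N + 1 : ℕ) : ℝ) := by positivity
  rw [one_div, inv_mul_le_iff₀ hN]
  refine (Finset.abs_sum_le_sum_abs _ _).trans ((Finset.sum_le_sum fun j _ => hj j).trans ?_)
  rw [Finset.sum_const, Finset.card_range, nsmul_eq_mul]

/-- Centred sums are countably additive over a measurable partition. -/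
theorem enorm_centredSum_le_tsum {κ : Type*} [Countable κ] {A : κ → Set E}
    (hA : ∀ i, MeasurableSet (A i)) (hdisj : Pairwise (Function.onFun Disjoint A))
    (hcover : ∀ y, ∃ i, y ∈ A i) {f : E → ℝ} (hf : Integrable f μ) (x : ι → E) :
    ‖centredSum μ f x‖ₑ ≤ ∑' i, ‖centredSum μ ((A i).indicator f) x‖ₑ := by
  have hpt : ∀ y, HasSum (fun i => (A i).indicator f y) (f y) := by
    intro y
    obtain ⟨i, hi⟩ := hcover y
    have := hasSum_single (f := fun i => (A i).indicator f y) i fun j hj => by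
      refine Set.indicator_of_notMem (fun hyj => ?_) _
      exact Set.disjoint_left.1 (hdisj hj) hyj hi
    simpa [Set.indicator_of_mem hi] using this
  have hint : HasSum (fun i => ∫ y, (A i).indicator f y ∂μ) (∫ y, f y ∂μ) := by
    have h1 := hasSum_integral_iUnion hA hdisj (f := f) (μ := μ) hf.integrableOn
    rw [Set.iUnion_eq_univ_iff.2 hcover, setIntegral_univ] at h1
    simpa only [fun i => integral_indicator (f := f) (μ := μ) (hA i)] using h1
  have hsum : HasSum (fun i => centredSum μ ((A i).indicator f) x) (centredSum μ f x) :=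
    hasSum_sum (s := Finset.univ) (f := fun (j : ι) (i : κ) => (A i).indicator f (x j) - ∫ y, (A i).indicator f y ∂μ)
      fun j _ => (hpt (x j)).sub hint
  rw [← hsum.tsum_eq]
  exact enorm_tsum_le_tsum_enorm

end Monotone

/-! ### Decomposition of likelihood ratios over dyadic shells of `g₀`. -/

section Shells

variable {M γ c : ℝ} {g₀ : ℝ → ℝ}

theorem UnimodalAbout.measurable {f : ℝ → ℝ} (hf : UnimodalAbout c f) : Measurable f := by
  have h1 : Monotone fun y => f (min y c) := fun y z hyz =>
    hf.1 (Set.mem_Iic.2 (min_le_right _ _)) (Set.mem_Iic.2 (min_le_right _ _)) (min_le_min_right _ hyz)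
  have h2 : Antitone fun y => f (max y c) := fun y z hyz =>
    hf.2 (Set.mem_Ici.2 (le_max_right _ _)) (Set.mem_Ici.2 (le_max_right _ _)) (max_le_max_right _ hyz)
  have : f = fun y => if y ≤ c then f (min y c) else f (max y c) := by
    funext y
    split_ifs with h
    · rw [min_eq_left h]
    · rw [max_eq_left (not_le.1 h).le]
  rw [this]
  exact Measurable.ite measurableSet_Iic h1.measurable h2.measurable

theorem UnimodalAbout.le_mode {f : ℝ → ℝ} (hf : UnimodalAbout c f) (y : ℝ) : f y ≤ f c := by
  rcases le_total y c with h | h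
  · exact hf.1 h Set.self_mem_Iic h
  · exact hf.2 Set.self_mem_Ici h h

/-- The part of one side of `c` on which `g₀ / g₀ c` lies between consecutive powers of `1/2`. -/
def shell (c : ℝ) (g₀ : ℝ → ℝ) (i : Bool × ℕ) : Set ℝ :=
  {y | (if i.1 then y ≤ c else c < y) ∧
    (1 / 2 : ℝ) ^ (i.2 + 1) < g₀ y / g₀ c ∧ g₀ y / g₀ c ≤ (1 / 2 : ℝ) ^ i.2}

/-- The ranking that makes unimodal functions monotone on the given side of `c`. -/
def sideRank (s : Bool) (y : ℝ) : ℝ := if s then y else -y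

theorem measurable_sideRank (s : Bool) : Measurable (sideRank s) := by
  cases s
  · exact measurable_neg
  · exact measurable_id

theorem measurableSet_shell (hg : Measurable g₀) (i : Bool × ℕ) : MeasurableSet (shell c g₀ i) := by
  have h1 : MeasurableSet {y : ℝ | if i.1 then y ≤ c else c < y} := by
    rcases i with ⟨_ | _, k⟩
    · show MeasurableSet {y : ℝ | if false = true then y ≤ c else c < y}
      simp only [Bool.false_eq_true, if_false]
      exact measurableSet_Ioi
    · exact measurableSet_Iic (a := c)
  exact h1.inter ((measurableSet_lt measurable_const (hg.div_const _)).inter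
    (measurableSet_le (hg.div_const _) measurable_const))

theorem pairwise_disjoint_shell : Pairwise (Function.onFun Disjoint (shell c g₀)) := by
  rintro ⟨s, k⟩ ⟨t, l⟩ hne
  refine Set.disjoint_left.2 fun y hy hy' => hne ?_
  have hst : s = t := by
    have h1 := hy.1
    have h2 := hy'.1
    cases s <;> cases t <;> simp at h1 h2 ⊢ <;> linarith
  have key : ∀ k l : ℕ, (1 / 2 : ℝ) ^ (k + 1) < (1 / 2 : ℝ) ^ l → l ≤ k := by
    intro k l h
    by_contra hlt
    exact absurd h (not_lt.2 (pow_le_pow_of_le_one (by norm_num) (by norm_num) (by omega)))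
  rw [hst, le_antisymm (key l k (hy'.2.1.trans_le hy.2.2)) (key k l (hy.2.1.trans_le hy'.2.2))]

theorem exists_mem_shell (hpos : ∀ y, 0 < g₀ y) (huni : UnimodalAbout c g₀) (y : ℝ) :
    ∃ i, y ∈ shell c g₀ i := by
  obtain ⟨k, hk⟩ := exists_nat_pow_near_of_lt_one (div_pos (hpos y) (hpos c))
    ((div_le_one (hpos c)).2 (huni.le_mode y)) (show (0 : ℝ) < 1 / 2 by norm_num) (by norm_num)
  rcases le_or_gt y c with h | h
  · exact ⟨(true, k), by simpa using h, hk⟩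
  · exact ⟨(false, k), by simpa using h, hk⟩

/-- The cap on members of the shape class over the `k`-th shells. -/
noncomputable def shellCap (M γ c : ℝ) (g₀ : ℝ → ℝ) (k : ℕ) : ℝ :=
  (M * g₀ c * (1 / 2) ^ k) ^ (1 / (1 - γ))

/-- The weight `φ / g₀` on a shell, scaled by the cap. -/
noncomputable def shellWeight (M γ c : ℝ) (g₀ φ : ℝ → ℝ) (i : Bool × ℕ) : ℝ → ℝ :=
  (shell c g₀ i).indicator fun y => φ y / g₀ y * shellCap M γ c g₀ i.2

/-- The constant in the bound of the shell weights. -/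
noncomputable def weightConst (M γ c : ℝ) (g₀ : ℝ → ℝ) : ℝ :=
  2 * (M * g₀ c) ^ (1 / (1 - γ)) / g₀ c

/-- The rate at which the shell weights decay. -/
noncomputable def weightRate (γ : ℝ) : ℝ := 2 * (1 / 2) ^ (1 / (1 - γ))

theorem shellCap_pos (hM : 0 < M) (hpos : ∀ y, 0 < g₀ y) (k : ℕ) : 0 < shellCap M γ c g₀ k :=
  Real.rpow_pos_of_pos (mul_pos (mul_pos hM (hpos c)) (by positivity)) _

theorem weightConst_pos (hM : 0 < M) (hpos : ∀ y, 0 < g₀ y) : 0 < weightConst M γ c g₀ :=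
  div_pos (mul_pos two_pos (Real.rpow_pos_of_pos (mul_pos hM (hpos c)) _)) (hpos c)

theorem weightRate_pos (γ : ℝ) : 0 < weightRate γ := by
  unfold weightRate
  positivity

theorem one_lt_exponent (hγ : γ ∈ Set.Ioo (0 : ℝ) 1) : 1 < 1 / (1 - γ) := by
  rw [lt_div_iff₀ (by linarith [hγ.2])]
  linarith [hγ.1]

/-- The exponent `1 / (1 - γ)` exceeds one, so from shell to shell the cap shrinks faster than `g₀`,
and the shell weights have a convergent geometric sum. -/
theorem weightRate_lt_one (hγ : γ ∈ Set.Ioo (0 : ℝ) 1) : weightRate γ < 1 := by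
  have h := Real.rpow_lt_rpow_of_exponent_gt (show (0 : ℝ) < 1 / 2 by norm_num) (by norm_num)
    (one_lt_exponent hγ)
  rw [Real.rpow_one] at h
  unfold weightRate
  linarith

/-- On the `k`-th shell, division by `g₀` costs at most `2 ^ (k + 1) / g₀ c`, while the cap gains
`(1 / 2) ^ (k / (1 - γ))`. -/
theorem abs_shellWeight_le (hM : 0 < M) (hpos : ∀ y, 0 < g₀ y) (φ : ℝ → ℝ) (i : Bool × ℕ) (y : ℝ) :
    |shellWeight M γ c g₀ φ i y| ≤ weightConst M γ c g₀ * weightRate γ ^ i.2 * |φ y| := by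
  have hR : 0 ≤ weightConst M γ c g₀ * weightRate γ ^ i.2 * |φ y| :=
    mul_nonneg (mul_nonneg (weightConst_pos hM hpos).le (pow_nonneg (weightRate_pos γ).le _))
      (abs_nonneg _)
  by_cases hy : y ∈ shell c g₀ i
  · rw [shellWeight, Set.indicator_of_mem hy, abs_mul, abs_div, abs_of_pos (hpos y),
      abs_of_pos (shellCap_pos hM hpos i.2)]
    have hg : g₀ c * (1 / 2) ^ (i.2 + 1) ≤ g₀ y := by
      have := (lt_div_iff₀ (hpos c)).1 hy.2.1
      linarith
    have hgpos : 0 < g₀ c * (1 / 2 : ℝ) ^ (i.2 + 1) := mul_pos (hpos c) (by positivity)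
    calc |φ y| / g₀ y * shellCap M γ c g₀ i.2
        ≤ |φ y| / (g₀ c * (1 / 2) ^ (i.2 + 1)) * shellCap M γ c g₀ i.2 := by
          gcongr
          exact (shellCap_pos hM hpos i.2).le
      _ = weightConst M γ c g₀ * weightRate γ ^ i.2 * |φ y| := by
          have h1 : shellCap M γ c g₀ i.2 =
              (M * g₀ c) ^ (1 / (1 - γ)) * ((1 / 2 : ℝ) ^ (1 / (1 - γ))) ^ i.2 := by
            rw [shellCap, Real.mul_rpow (mul_pos hM (hpos c)).le (by positivity),
              ← Real.rpow_natCast ((1 / 2 : ℝ) ^ (1 / (1 - γ))), ← Real.rpow_mul (by norm_num),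
              ← Real.rpow_natCast (1 / 2 : ℝ), ← Real.rpow_mul (by norm_num), mul_comm (i.2 : ℝ)]
          have h2 := (hpos c).ne'
          have h3 : (1 / 2 : ℝ) ^ (i.2 + 1) = (2 * 2 ^ i.2)⁻¹ := by
            rw [one_div, inv_pow, pow_succ, mul_comm]
          rw [h1, h3, weightConst, weightRate, mul_pow]
          field_simp
  · rw [shellWeight, Set.indicator_of_notMem hy, abs_zero]
    exact hR

theorem measurable_shellWeight (hg : Measurable g₀) {φ : ℝ → ℝ} (hφ : Measurable φ)
    (i : Bool × ℕ) : Measurable (shellWeight M γ c g₀ φ i) :=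
  ((hφ.div hg).mul_const _).indicator (measurableSet_shell hg i)

/-- A uniform bound on the likelihood ratios. -/
theorem likelihoodRatio_bound (hM : 0 < M) (hγ : γ ∈ Set.Ioo (0 : ℝ) 1) (hpos : ∀ y, 0 < g₀ y)
    (huni : UnimodalAbout c g₀) {L : ℝ → ℝ} (hL : L ∈ likelihoodRatios (shapeClass M γ c g₀) g₀)
    (y : ℝ) : |L y| ≤ M * (M * g₀ c) ^ (1 / (1 - γ) - 1) := by
  obtain ⟨f, ⟨hf, -⟩, rfl⟩ := hL
  have hMy : 0 < M * g₀ y := mul_pos hM (hpos y)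
  simp only
  rw [abs_of_nonneg (div_nonneg (hf y).1 (hpos y).le), div_le_iff₀ (hpos y)]
  calc f y ≤ (M * g₀ y) ^ (1 / (1 - γ)) := (hf y).2
    _ = (M * g₀ y) ^ (1 / (1 - γ) - 1) * (M * g₀ y) := by
        rw [Real.rpow_sub_one hMy.ne', div_mul_cancel₀ _ hMy.ne']
    _ ≤ (M * g₀ c) ^ (1 / (1 - γ) - 1) * (M * g₀ y) := by
        gcongr
        · linarith [one_lt_exponent hγ]
        · exact huni.le_mode y
    _ = M * (M * g₀ c) ^ (1 / (1 - γ) - 1) * g₀ y := by ring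

theorem likelihoodRatio_measurable (hg : Measurable g₀) {L : ℝ → ℝ}
    (hL : L ∈ likelihoodRatios (shapeClass M γ c g₀) g₀) : Measurable L := by
  obtain ⟨f, ⟨-, hf⟩, rfl⟩ := hL
  exact hf.measurable.div hg

theorem integrable_mul_likelihoodRatio {μ : Measure ℝ} (hM : 0 < M) (hγ : γ ∈ Set.Ioo (0 : ℝ) 1)
    (hpos : ∀ y, 0 < g₀ y) (hg : Measurable g₀) (huni : UnimodalAbout c g₀) {φ : ℝ → ℝ}
    (hφ : Integrable φ μ) {L : ℝ → ℝ} (hL : L ∈ likelihoodRatios (shapeClass M γ c g₀) g₀) :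
    Integrable (fun y => φ y * L y) μ :=
  hφ.mul_bdd (likelihoodRatio_measurable hg hL).aestronglyMeasurable
    (ae_of_all _ fun y => likelihoodRatio_bound hM hγ hpos huni hL y)

theorem convex_likelihoodRatios (M γ c : ℝ) (g₀ : ℝ → ℝ) :
    Convex ℝ (likelihoodRatios (shapeClass M γ c g₀) g₀) := by
  rintro _ ⟨f, ⟨hf, hf1, hf2⟩, rfl⟩ _ ⟨g, ⟨hg, hg1, hg2⟩, rfl⟩ a b ha hb hab
  refine ⟨fun y => a * f y + b * g y, ⟨fun y => ⟨?_, ?_⟩, ?_, ?_⟩, ?_⟩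
  · exact add_nonneg (mul_nonneg ha (hf y).1) (mul_nonneg hb (hg y).1)
  · calc a * f y + b * g y ≤ a * (M * g₀ y) ^ (1 / (1 - γ)) + b * (M * g₀ y) ^ (1 / (1 - γ)) :=
          add_le_add (mul_le_mul_of_nonneg_left (hf y).2 ha)
            (mul_le_mul_of_nonneg_left (hg y).2 hb)
      _ = _ := by rw [← add_mul, hab, one_mul]
  · exact fun y hy z hz h => add_le_add (mul_le_mul_of_nonneg_left (hf1 hy hz h) ha)
      (mul_le_mul_of_nonneg_left (hg1 hy hz h) hb)
  · exact fun y hy z hz h => add_le_add (mul_le_mul_of_nonneg_left (hf2 hy hz h) ha)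
      (mul_le_mul_of_nonneg_left (hg2 hy hz h) hb)
  · funext y
    simp only [Pi.add_apply, Pi.smul_apply, smul_eq_mul]
    ring

variable {ι : Type*} [Fintype ι] {μ : Measure ℝ}

/-- A measurable bound on the centred sums of `φ L`, uniform over likelihood ratios `L`. -/
noncomputable def shellEnvelope (μ : Measure ℝ) (M γ c : ℝ) (g₀ φ : ℝ → ℝ) (x : ι → ℝ) : ℝ≥0∞ :=
  ∑' i : Bool × ℕ, centredSup μ (truncations (sideRank i.1) (shellWeight M γ c g₀ φ i)) x

theorem measurable_shellEnvelope (hg : Measurable g₀) {φ : ℝ → ℝ} (hφ : Measurable φ) :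
    Measurable (shellEnvelope (ι := ι) μ M γ c g₀ φ) :=
  Measurable.tsum fun i => measurable_centredSup fun q =>
    measurable_truncations (measurable_sideRank i.1) (measurable_shellWeight hg hφ i) q

/-- On each shell `φ L` is the shell weight times `f` divided by the cap. The latter has values in
`[0, 1]` and is monotone in the ranking of its side, so the half-line bound applies shell by shell,
independently of `L`. -/
theorem enorm_centredSum_le_shellEnvelope (hM : 0 < M) (hγ : γ ∈ Set.Ioo (0 : ℝ) 1)
    (hpos : ∀ y, 0 < g₀ y) (hg : Measurable g₀) (huni : UnimodalAbout c g₀) {φ : ℝ → ℝ}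
    (hφm : Measurable φ) (hφ : Integrable φ μ) {L : ℝ → ℝ}
    (hL : L ∈ likelihoodRatios (shapeClass M γ c g₀) g₀) (x : ι → ℝ) :
    ‖centredSum μ (fun y => φ y * L y) x‖ₑ ≤ shellEnvelope μ M γ c g₀ φ x := by
  refine (enorm_centredSum_le_tsum (measurableSet_shell hg) pairwise_disjoint_shell
    (exists_mem_shell hpos huni)
    (integrable_mul_likelihoodRatio hM hγ hpos hg huni hφ hL) x).trans ?_
  refine ENNReal.tsum_le_tsum fun i => ?_
  obtain ⟨f, ⟨hf, hf1, hf2⟩, rfl⟩ := hL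
  have hcap := shellCap_pos (γ := γ) (c := c) hM hpos i.2
  have hsplit : (shell c g₀ i).indicator (fun y => φ y * (f y / g₀ y)) =
      fun y => shellWeight M γ c g₀ φ i y * (f y / shellCap M γ c g₀ i.2) := by
    funext y
    by_cases hy : y ∈ shell c g₀ i
    · rw [shellWeight, Set.indicator_of_mem hy, Set.indicator_of_mem hy]
      have := (hpos y).ne'
      field_simp
    · rw [shellWeight, Set.indicator_of_notMem hy, Set.indicator_of_notMem hy, zero_mul]
  rw [hsplit]
  refine enorm_centredSum_mul_le (measurable_sideRank i.1) (measurable_shellWeight hg hφm i) ?_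
    (S := shell c g₀ i) (fun y hy => Set.indicator_of_notMem hy _) (fun y hy => ⟨?_, ?_⟩) ?_ x
  · refine (hφ.abs.const_mul (weightConst M γ c g₀ * weightRate γ ^ i.2)).mono
      (measurable_shellWeight hg hφm i).aestronglyMeasurable (ae_of_all _ fun y => ?_)
    exact (abs_shellWeight_le hM hpos φ i y).trans (le_abs_self _)
  · exact div_nonneg (hf y).1 hcap.le
  · rw [div_le_one hcap]
    refine (hf y).2.trans (Real.rpow_le_rpow (mul_pos hM (hpos y)).le ?_
      (zero_le_one.trans (one_lt_exponent hγ).le))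
    rw [mul_assoc]
    have := (div_le_iff₀ (hpos c)).1 hy.2.2
    exact mul_le_mul_of_nonneg_left (by linarith) hM.le
  · intro y hy z hz hyz
    refine div_le_div_of_nonneg_right ?_ hcap.le
    rcases i with ⟨_ | _, k⟩
    · have h1 : c < y := by simpa using hy.1
      have h2 : c < z := by simpa using hz.1
      exact hf2 h2.le h1.le (by simpa [sideRank] using hyz)
    · have h1 : y ≤ c := by simpa using hy.1
      have h2 : z ≤ c := by simpa using hz.1
      exact hf1 h1 h2 (by simpa [sideRank] using hyz)

/-- The uniform bound has mean of order `√n`. -/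
theorem exists_lintegral_shellEnvelope_le [IsProbabilityMeasure μ] (hM : 0 < M)
    (hγ : γ ∈ Set.Ioo (0 : ℝ) 1) (hpos : ∀ y, 0 < g₀ y) (hg : Measurable g₀) {φ : ℝ → ℝ}
    (hφm : Measurable φ) (hφ : MemLp φ 2 μ) :
    ∃ C : ℝ, 0 < C ∧ ∀ n : ℕ, 1 ≤ n →
      ∫⁻ x : Fin n → ℝ, shellEnvelope μ M γ c g₀ φ x ∂(Measure.pi fun _ => μ) ≤
        ENNReal.ofReal (C * √n) := by
  set K := weightConst M γ c g₀ with hK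
  set θ := weightRate γ with hθ
  have hK0 : 0 < K := weightConst_pos hM hpos
  have hθ0 : 0 < θ := weightRate_pos γ
  have hθ1 : θ < 1 := weightRate_lt_one hγ
  set I := ∫ y, φ y ^ 2 ∂μ with hI
  have hI0 : 0 ≤ I := integral_nonneg fun y => sq_nonneg _
  -- The added `1` keeps the bound positive even if `φ` vanishes almost everywhere.
  set A := √(8 * I + 1) with hA
  have hA0 : 0 < A := Real.sqrt_pos.2 (by positivity)
  have hA2 : A ^ 2 = 8 * I + 1 := Real.sq_sqrt (by positivity)
  refine ⟨2 * (2 * (K * A) / (1 - θ)), by have := sub_pos.2 hθ1; positivity, fun n hn => ?_⟩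
  have hn0 : (0 : ℝ) < n := by exact_mod_cast hn
  have hsn : 0 < √(n : ℝ) := Real.sqrt_pos.2 hn0
  have hterm : ∀ i : Bool × ℕ, ∫⁻ x : Fin n → ℝ,
      centredSup μ (truncations (sideRank i.1) (shellWeight M γ c g₀ φ i)) x
        ∂(Measure.pi fun _ => μ) ≤ ENNReal.ofReal (2 * (√n * (K * θ ^ i.2 * A))) := by
    intro i
    have hw := abs_shellWeight_le (γ := γ) (c := c) hM hpos φ i
    have hwm := measurable_shellWeight (M := M) (γ := γ) (c := c) hg hφm i
    have hmem : MemLp (shellWeight M γ c g₀ φ i) 2 μ := by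
      refine (hφ.const_mul (K * θ ^ i.2)).mono hwm.aestronglyMeasurable (ae_of_all _ fun y => ?_)
      have hpow : 0 < K * θ ^ i.2 := by positivity
      rw [Real.norm_eq_abs, Real.norm_eq_abs, abs_mul, abs_of_pos hpow]
      exact hw y
    refine lintegral_centredSup_truncations_le (measurable_sideRank i.1) hwm hmem
      (by positivity) ?_
    have hle : ∫ y, shellWeight M γ c g₀ φ i y ^ 2 ∂μ ≤ (K * θ ^ i.2) ^ 2 * I := by
      rw [hI, ← integral_const_mul]
      refine integral_mono hmem.integrable_sq (hφ.integrable_sq.const_mul _) fun y => ?_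
      have := pow_le_pow_left₀ (abs_nonneg _) (hw y) 2
      rw [sq_abs, mul_pow, sq_abs] at this
      exact this
    rw [mul_pow, Real.sq_sqrt hn0.le, mul_pow, hA2, Fintype.card_fin]
    have hpos' : 0 ≤ (K * θ ^ i.2) ^ 2 := sq_nonneg _
    calc 8 * (n * ∫ y, shellWeight M γ c g₀ φ i y ^ 2 ∂μ)
        ≤ 8 * (n * ((K * θ ^ i.2) ^ 2 * I)) := by gcongr
      _ = n * ((K * θ ^ i.2) ^ 2 * (8 * I)) := by ring
      _ ≤ n * ((K * θ ^ i.2) ^ 2 * (8 * I + 1)) := by gcongr; linarith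
  have hgeom : HasSum (fun k : ℕ => 2 * (√n * (K * θ ^ k * A))) (2 * (K * A) / (1 - θ) * √n) := by
    have h := (hasSum_geometric_of_lt_one hθ0.le hθ1).mul_left (2 * (√n * (K * A)))
    rw [show 2 * (√n * (K * A)) * (1 - θ)⁻¹ = 2 * (K * A) / (1 - θ) * √n by ring] at h
    convert! h using 2 with k
    ring
  calc ∫⁻ x : Fin n → ℝ, shellEnvelope μ M γ c g₀ φ x ∂(Measure.pi fun _ => μ)
      = ∑' i : Bool × ℕ, ∫⁻ x : Fin n → ℝ,
          centredSup μ (truncations (sideRank i.1) (shellWeight M γ c g₀ φ i)) x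
            ∂(Measure.pi fun _ => μ) :=
        lintegral_tsum fun i => (measurable_centredSup fun q =>
          measurable_truncations (measurable_sideRank i.1)
            (measurable_shellWeight hg hφm i) q).aemeasurable
    _ ≤ ∑' i : Bool × ℕ, ENNReal.ofReal (2 * (√n * (K * θ ^ i.2 * A))) :=
        ENNReal.tsum_le_tsum hterm
    _ = ∑' _ : Bool, ENNReal.ofReal (2 * (K * A) / (1 - θ) * √n) := by
        rw [ENNReal.tsum_prod (f := fun (_ : Bool) (k : ℕ) =>
          ENNReal.ofReal (2 * (√n * (K * θ ^ k * A))))]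
        refine tsum_congr fun _ => ?_
        rw [← ENNReal.ofReal_tsum_of_nonneg (fun k => by positivity) hgeom.summable, hgeom.tsum_eq]
    _ = ENNReal.ofReal (2 * (2 * (K * A) / (1 - θ)) * √n) := by
        rw [tsum_fintype, Fintype.sum_bool, ← two_mul, mul_assoc, ENNReal.ofReal_mul zero_le_two,
          ENNReal.ofReal_ofNat]

end Shells

/-! ### Almost sure convergence of the uniform bound -/

section AlmostSure

/-- A sequence with controlled increments that is `o(n)` along fourth powers is `o(n)`. -/
theorem tendsto_div_of_tendsto_div_pow_four {e : ℕ → ℝ≥0∞} {T : ℕ → ℝ} {τ : ℝ}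
    (hinc : ∀ m n, m ≤ n → e n ≤ e m + ENNReal.ofReal (T n - T m))
    (hT : Tendsto (fun n : ℕ => T n / n) atTop (𝓝 τ))
    (hsub : Tendsto (fun k : ℕ => e (k ^ 4) / ((k ^ 4 : ℕ) : ℝ≥0∞)) atTop (𝓝 0)) :
    Tendsto (fun n : ℕ => e n / (n : ℝ≥0∞)) atTop (𝓝 0) := by
  set x : ℕ → ℝ := fun n => (n : ℝ) ^ (1 / 4 : ℝ) with hx
  have hx0 : ∀ n, 0 ≤ x n := fun n => by positivity
  have hx4 : ∀ n, x n ^ 4 = n := fun n => by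
    rw [hx, ← Real.rpow_natCast, ← Real.rpow_mul (Nat.cast_nonneg n)]
    norm_num
  have hxtop : Tendsto x atTop atTop :=
    (tendsto_rpow_atTop (by norm_num)).comp tendsto_natCast_atTop_atTop
  -- `κ n ^ 4` is the largest fourth power not exceeding `n`. Its ratio to `n` tends to one, so the
  -- increment of `T` between them is `o(n)`.
  set κ : ℕ → ℕ := fun n => ⌊x n⌋₊ with hκ
  have hκtop : Tendsto κ atTop atTop := tendsto_nat_floor_atTop.comp hxtop
  have hle : ∀ n, κ n ^ 4 ≤ n := fun n => by
    have : ((κ n ^ 4 : ℕ) : ℝ) ≤ n := by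
      rw [← hx4 n]
      push_cast
      exact pow_le_pow_left₀ (Nat.cast_nonneg _) (Nat.floor_le (hx0 n)) 4
    exact_mod_cast this
  have hmtop : Tendsto (fun n => κ n ^ 4) atTop atTop :=
    (tendsto_pow_atTop (by norm_num)).comp hκtop
  have hratio : Tendsto (fun n : ℕ => ((κ n ^ 4 : ℕ) : ℝ) / n) atTop (𝓝 1) := by
    have h := (tendsto_nat_floor_div_atTop.comp hxtop).pow 4
    rw [one_pow] at h
    refine h.congr fun n => ?_
    simp only [Function.comp, div_pow, hx4, hκ, Nat.cast_pow]
  have hTm : Tendsto (fun n => T n / n - T (κ n ^ 4) / ((κ n ^ 4 : ℕ) : ℝ) *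
      (((κ n ^ 4 : ℕ) : ℝ) / n)) atTop (𝓝 0) := by
    simpa using hT.sub ((hT.comp hmtop).mul hratio)
  have h1 : Tendsto (fun n => e (κ n ^ 4) / ((κ n ^ 4 : ℕ) : ℝ≥0∞) + ENNReal.ofReal
      (T n / n - T (κ n ^ 4) / ((κ n ^ 4 : ℕ) : ℝ) * (((κ n ^ 4 : ℕ) : ℝ) / n))) atTop (𝓝 0) := by
    simpa using (hsub.comp hκtop).add (ENNReal.tendsto_ofReal hTm)
  refine tendsto_of_tendsto_of_tendsto_of_le_of_le' tendsto_const_nhds h1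
    (Eventually.of_forall fun _ => zero_le) ?_
  filter_upwards [hmtop.eventually_gt_atTop 0] with n hn
  have hn0 : 0 < n := hn.trans_le (hle n)
  calc e n / (n : ℝ≥0∞)
      ≤ (e (κ n ^ 4) + ENNReal.ofReal (T n - T (κ n ^ 4))) / n := by
        gcongr
        exact hinc _ _ (hle n)
    _ = e (κ n ^ 4) / n + ENNReal.ofReal ((T n - T (κ n ^ 4)) / n) := by
        rw [ENNReal.add_div, ENNReal.ofReal_div_of_pos (by exact_mod_cast hn0),
          ENNReal.ofReal_natCast]
    _ ≤ _ := by
        gcongr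
        · exact hle n
        · refine le_of_eq ?_
          have : ((κ n ^ 4 : ℕ) : ℝ) ≠ 0 := by exact_mod_cast hn.ne'
          have : (n : ℝ) ≠ 0 := by exact_mod_cast hn0.ne'
          field_simp

variable {M γ c : ℝ} {g₀ : ℝ → ℝ} {μ : Measure ℝ}

/-- Each added point changes a centred sum by at most its own weight plus the mean weight, uniformly
in the threshold. -/
theorem centredSup_fin_le {r h φ : ℝ → ℝ} {w A : ℝ} (hint : Integrable h μ)
    (hφ : ∀ y, |h y| ≤ w * |φ y|) (hA : ∫ y, |h y| ∂μ ≤ w * A) (x : ℕ → ℝ) {m n : ℕ} (hmn : m ≤ n) :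
    centredSup μ (truncations r h) (fun i : Fin n => x i) ≤
      centredSup μ (truncations r h) (fun i : Fin m => x i) +
        ENNReal.ofReal (w * ∑ i ∈ Finset.Ico m n, (|φ (x i)| + A)) := by
  refine iSup_le fun q => ?_
  set ξ : ℕ → ℝ := fun i => truncations r h q (x i) - ∫ y, truncations r h q y ∂μ with hξ
  have hsplit : ∑ i : Fin n, ξ i = ∑ i : Fin m, ξ i + ∑ i ∈ Finset.Ico m n, ξ i := by
    rw [Fin.sum_univ_eq_sum_range, Fin.sum_univ_eq_sum_range, Finset.sum_range_add_sum_Ico _ hmn]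
  have hterm : ∀ i, |ξ i| ≤ w * (|φ (x i)| + A) := by
    intro i
    rw [mul_add]
    refine (abs_sub _ _).trans (add_le_add ((abs_truncations_le r h q _).trans (hφ _)) ?_)
    refine (abs_integral_le_integral_abs).trans (le_trans ?_ hA)
    exact integral_mono_of_nonneg (ae_of_all _ fun y => abs_nonneg _) hint.abs
      (ae_of_all _ fun y => abs_truncations_le r h q y)
  show ‖∑ i : Fin n, ξ i‖ₑ ≤ _
  rw [hsplit]
  refine (enorm_add_le _ _).trans (add_le_add ?_ ?_)
  · exact le_iSup (fun q => ‖∑ i : Fin m, (truncations r h q (x i) -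
      ∫ y, truncations r h q y ∂μ)‖ₑ) q
  · rw [Real.enorm_eq_ofReal_abs, Finset.mul_sum]
    exact ENNReal.ofReal_le_ofReal
      ((Finset.abs_sum_le_sum_abs _ _).trans (Finset.sum_le_sum fun i _ => hterm i))

theorem shellEnvelope_fin_le (hM : 0 < M) (hγ : γ ∈ Set.Ioo (0 : ℝ) 1) (hpos : ∀ y, 0 < g₀ y)
    (hg : Measurable g₀) {φ : ℝ → ℝ} (hφm : Measurable φ) (hφ : Integrable φ μ) (x : ℕ → ℝ)
    {m n : ℕ} (hmn : m ≤ n) :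
    shellEnvelope μ M γ c g₀ φ (fun i : Fin n => x i) ≤
      shellEnvelope μ M γ c g₀ φ (fun i : Fin m => x i) +
        ENNReal.ofReal (2 * weightConst M γ c g₀ / (1 - weightRate γ) *
          ∑ i ∈ Finset.Ico m n, (|φ (x i)| + ∫ y, |φ y| ∂μ)) := by
  set K := weightConst M γ c g₀
  set θ := weightRate γ
  have hK0 : 0 < K := weightConst_pos hM hpos
  have hθ0 : 0 < θ := weightRate_pos γ
  have hθ1 : θ < 1 := weightRate_lt_one hγ
  set A := ∫ y, |φ y| ∂μ with hA
  have hA0 : 0 ≤ A := integral_nonneg fun y => abs_nonneg _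
  set S := ∑ i ∈ Finset.Ico m n, (|φ (x i)| + A)
  have hS0 : 0 ≤ S := Finset.sum_nonneg fun i _ => by positivity
  have hgeom : HasSum (fun k : ℕ => K * θ ^ k * S) (K / (1 - θ) * S) := by
    have h := ((hasSum_geometric_of_lt_one hθ0.le hθ1).mul_left K).mul_right S
    rwa [← div_eq_mul_inv] at h
  have htsum : ∑' i : Bool × ℕ, ENNReal.ofReal (K * θ ^ i.2 * S) =
      ENNReal.ofReal (2 * K / (1 - θ) * S) := by
    rw [ENNReal.tsum_prod (f := fun (_ : Bool) (k : ℕ) => ENNReal.ofReal (K * θ ^ k * S))]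
    rw [← ENNReal.ofReal_tsum_of_nonneg (fun k => by positivity) hgeom.summable, hgeom.tsum_eq,
      tsum_fintype, Fintype.sum_bool, ← two_mul, ← ENNReal.ofReal_ofNat,
      ← ENNReal.ofReal_mul zero_le_two]
    congr 1
    ring
  rw [← htsum]
  unfold shellEnvelope
  rw [← ENNReal.tsum_add]
  refine ENNReal.tsum_le_tsum fun i => ?_
  have hw := abs_shellWeight_le (γ := γ) (c := c) hM hpos φ i
  have hint : Integrable (shellWeight M γ c g₀ φ i) μ :=
    (hφ.abs.const_mul (K * θ ^ i.2)).mono (measurable_shellWeight hg hφm i).aestronglyMeasurable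
      (ae_of_all _ fun y => (hw y).trans (le_abs_self _))
  refine centredSup_fin_le hint hw ?_ x hmn
  rw [hA, ← integral_const_mul]
  exact integral_mono hint.abs (hφ.abs.const_mul _) hw

/-- The uniform bound for the sampled problem of size `n`. -/
noncomputable def meanEnvelope {Ω : Type*} (μ : Measure ℝ) (M γ c : ℝ) (g₀ φ : ℝ → ℝ)
    (X : ℕ → Ω → ℝ) (n : ℕ) (ω : Ω) : ℝ≥0∞ :=
  shellEnvelope μ M γ c g₀ φ (sample X n ω) / n

variable {Ω : Type*} [MeasurableSpace Ω] {P : Measure Ω}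
  {X : ℕ → Ω → ℝ}

theorem measurable_sample (hX : ∀ i, Measurable (X i)) (n : ℕ) : Measurable (sample X n) :=
  measurable_pi_lambda _ fun i => hX i

theorem map_sample (hX : ∀ i, Measurable (X i)) (hindep : iIndepFun X P)
    (hlaw : ∀ i, P.map (X i) = μ) (n : ℕ) : P.map (sample X n) = Measure.pi fun _ => μ := by
  have h := iIndepFun.map_fun_eq_pi_map (f := fun i : Fin n => X i)
    (fun i => (hX i).aemeasurable) (hindep.precomp Fin.val_injective)
  simp only [hlaw] at h
  exact h

theorem measurable_meanEnvelope (hX : ∀ i, Measurable (X i)) (hg : Measurable g₀) {φ : ℝ → ℝ}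
    (hφm : Measurable φ) (n : ℕ) : Measurable (meanEnvelope μ M γ c g₀ φ X n) :=
  ((measurable_shellEnvelope hg hφm).comp (measurable_sample hX n)).div_const _

theorem exists_lintegral_meanEnvelope_le [IsProbabilityMeasure μ] (hX : ∀ i, Measurable (X i))
    (hindep : iIndepFun X P) (hlaw : ∀ i, P.map (X i) = μ) (hM : 0 < M)
    (hγ : γ ∈ Set.Ioo (0 : ℝ) 1) (hpos : ∀ y, 0 < g₀ y) (hg : Measurable g₀) {φ : ℝ → ℝ}
    (hφm : Measurable φ) (hφ : MemLp φ 2 μ) :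
    ∃ C : ℝ, 0 < C ∧ ∀ n : ℕ, 1 ≤ n →
      ∫⁻ ω, meanEnvelope μ M γ c g₀ φ X n ω ∂P ≤ ENNReal.ofReal (C / √n) := by
  obtain ⟨C, hC, hle⟩ := exists_lintegral_shellEnvelope_le (c := c) hM hγ hpos hg hφm hφ
  refine ⟨C, hC, fun n hn => ?_⟩
  have hn0 : (0 : ℝ) < n := by exact_mod_cast hn
  have h1 : ∫⁻ ω, shellEnvelope μ M γ c g₀ φ (sample X n ω) ∂P =
      ∫⁻ x : Fin n → ℝ, shellEnvelope μ M γ c g₀ φ x ∂(Measure.pi fun _ => μ) := by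
    rw [← map_sample hX hindep hlaw n,
      lintegral_map (measurable_shellEnvelope hg hφm) (measurable_sample hX n)]
  calc ∫⁻ ω, meanEnvelope μ M γ c g₀ φ X n ω ∂P
      = (∫⁻ ω, shellEnvelope μ M γ c g₀ φ (sample X n ω) ∂P) / n := by
        simp only [meanEnvelope, div_eq_mul_inv]
        exact lintegral_mul_const _
          ((measurable_shellEnvelope hg hφm).comp (measurable_sample hX n))
    _ ≤ ENNReal.ofReal (C * √n) / n := by
        rw [h1]
        gcongr
        exact hle n hn
    _ = ENNReal.ofReal (C / √n) := by
        rw [← ENNReal.ofReal_natCast, ← ENNReal.ofReal_div_of_pos hn0, mul_div_assoc,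
          Real.sqrt_div_self', mul_one_div]

/-- Along fourth powers the means are `O(1/k²)`, hence summable, and the envelopes have an almost
surely finite sum. The strong law for `|φ (X i)|` controls the growth in between. -/
theorem ae_tendsto_meanEnvelope [IsProbabilityMeasure P] [IsProbabilityMeasure μ] (hX : ∀ i, Measurable (X i))
    (hindep : iIndepFun X P) (hlaw : ∀ i, P.map (X i) = μ) (hM : 0 < M)
    (hγ : γ ∈ Set.Ioo (0 : ℝ) 1) (hpos : ∀ y, 0 < g₀ y) (hg : Measurable g₀) {φ : ℝ → ℝ}
    (hφm : Measurable φ) (hφ : MemLp φ 2 μ) :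
    ∀ᵐ ω ∂P, Tendsto (fun n => meanEnvelope μ M γ c g₀ φ X n ω) atTop (𝓝 0) := by
  have hφi : Integrable φ μ := hφ.integrable (by norm_num)
  obtain ⟨C, hC, hle⟩ := exists_lintegral_meanEnvelope_le (c := c) hX hindep hlaw hM hγ hpos hg hφm hφ
  have hsub : ∀ᵐ ω ∂P, Tendsto (fun k : ℕ => meanEnvelope μ M γ c g₀ φ X ((k + 1) ^ 4) ω) atTop
      (𝓝 0) := by
    have hmeas : ∀ k : ℕ, Measurable (meanEnvelope μ M γ c g₀ φ X ((k + 1) ^ 4)) := fun k =>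
      measurable_meanEnvelope hX hg hφm _
    have hfin : ∫⁻ ω, ∑' k : ℕ, meanEnvelope μ M γ c g₀ φ X ((k + 1) ^ 4) ω ∂P ≠ ⊤ := by
      rw [lintegral_tsum fun k => (hmeas k).aemeasurable]
      have hsummable : Summable fun k : ℕ => C / ((k : ℝ) + 1) ^ 2 := by
        have h := (summable_nat_add_iff 1).2 (Real.summable_one_div_nat_pow.2 one_lt_two)
        refine (h.mul_left C).congr fun k => ?_
        push_cast
        ring
      refine ne_top_of_le_ne_top hsummable.tsum_ofReal_ne_top (ENNReal.tsum_le_tsum fun k => ?_)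
      refine (hle _ (Nat.one_le_pow _ _ (Nat.succ_pos k))).trans (le_of_eq ?_)
      congr 2
      push_cast
      rw [show ((k : ℝ) + 1) ^ 4 = (((k : ℝ) + 1) ^ 2) ^ 2 by ring, Real.sqrt_sq (by positivity)]
    filter_upwards [ae_lt_top (Measurable.tsum hmeas) hfin] with ω hω
    exact ENNReal.tendsto_atTop_zero_of_tsum_ne_top hω.ne
  have hslln := strong_law_ae_real (μ := P) (fun i ω => |φ (X i ω)|)
    (by
      have h := hφi.abs
      rw [← hlaw 0] at h
      exact h.comp_measurable (hX 0))
    (fun i j hij => (hindep.indepFun hij).comp (φ := fun y => |φ y|) (ψ := fun y => |φ y|)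
      hφm.abs hφm.abs)
    (fun i => (IdentDistrib.mk (hX i).aemeasurable (hX 0).aemeasurable
      ((hlaw i).trans (hlaw 0).symm)).comp (u := fun y => |φ y|) hφm.abs)
  filter_upwards [hsub, hslln] with ω h1 h2
  set K₁ := 2 * weightConst M γ c g₀ / (1 - weightRate γ)
  set A := ∫ y, |φ y| ∂μ
  refine tendsto_div_of_tendsto_div_pow_four
    (e := fun n => shellEnvelope μ M γ c g₀ φ (sample X n ω))
    (T := fun n => K₁ * ∑ i ∈ Finset.range n, (|φ (X i ω)| + A))
    (τ := K₁ * (P[fun ω => |φ (X 0 ω)|] + A)) (fun m n hmn => ?_) ?_ ?_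
  · refine (shellEnvelope_fin_le hM hγ hpos hg hφm hφi (fun i => X i ω) hmn).trans (le_of_eq ?_)
    rw [← mul_sub, ← Finset.sum_Ico_eq_sub _ hmn]
    rfl
  · refine ((h2.add_const A).const_mul K₁).congr' ?_
    filter_upwards [eventually_gt_atTop 0] with n hn
    have hn0 : (n : ℝ) ≠ 0 := by exact_mod_cast hn.ne'
    rw [Finset.sum_add_distrib, Finset.sum_const, Finset.card_range, nsmul_eq_mul]
    field_simp
  · exact (tendsto_add_atTop_iff_nat 1).1 h1

end AlmostSure

/-! ### The sampled and the true moments -/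

section Moments

variable {m k : ℕ}

/-- The functions whose moments the problem involves. -/
def momentFn (D : MomentData m k) : Option (Fin m ⊕ Fin k) → ℝ → ℝ
  | none => D.obj
  | some (.inl j) => D.ineq j
  | some (.inr j) => D.eq j

/-- The vector of moments of `L` under the expectation operator `E`. -/
def momentMap (E : (ℝ → ℝ) → ℝ) (D : MomentData m k) (L : ℝ → ℝ) : MomentSpace m k :=
  (E fun x => D.obj x * L x, fun j => E fun x => D.ineq j x * L x,
    fun j => E fun x => D.eq j x * L x)

theorem norm_momentMap_le {E : (ℝ → ℝ) → ℝ} {D : MomentData m k} {L : ℝ → ℝ} {b : ℝ}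
    (h : ∀ i, |E fun x => momentFn D i x * L x| ≤ b) : ‖momentMap E D L‖ ≤ b := by
  have hb : 0 ≤ b := (abs_nonneg _).trans (h none)
  refine norm_prod_le_iff.2 ⟨h none, norm_prod_le_iff.2 ⟨?_, ?_⟩⟩
  · exact (pi_norm_le_iff_of_nonneg hb).2 fun j => h (some (.inl j))
  · exact (pi_norm_le_iff_of_nonneg hb).2 fun j => h (some (.inr j))

theorem norm_momentMap_sub_le {E E' : (ℝ → ℝ) → ℝ} {D : MomentData m k} {L : ℝ → ℝ} {b : ℝ}
    (h : ∀ i, |(E fun x => momentFn D i x * L x) - E' fun x => momentFn D i x * L x| ≤ b) :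
    ‖momentMap E D L - momentMap E' D L‖ ≤ b :=
  norm_momentMap_le (E := fun φ => E φ - E' φ) h

theorem segmentAffine_momentMap {E : (ℝ → ℝ) → ℝ} {D : MomentData m k} {S : Set (ℝ → ℝ)}
    (h : ∀ i, ∀ L ∈ S, ∀ L' ∈ S, ∀ a b : ℝ, (E fun x => momentFn D i x * (a * L x + b * L' x)) =
      a * (E fun x => momentFn D i x * L x) + b * E fun x => momentFn D i x * L' x) :
    SegmentAffine S (momentMap E D) := by
  intro L hL L' hL' a b _ _ _
  refine Prod.ext (h none L hL L' hL' a b) (Prod.ext (funext fun j => ?_) (funext fun j => ?_))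
  · exact h (some (.inl j)) L hL L' hL' a b
  · exact h (some (.inr j)) L hL L' hL' a b

theorem segmentAffine_sampleMean (D : MomentData m k) (S : Set (ℝ → ℝ)) {n : ℕ} (x : Fin n → ℝ) :
    SegmentAffine S (momentMap (sampleMean x) D) := by
  refine segmentAffine_momentMap fun i L _ L' _ a b => ?_
  simp only [sampleMean, Finset.mul_sum, ← Finset.sum_add_distrib]
  exact Finset.sum_congr rfl fun _ _ => by ring

/-- The Bochner integral is additive only on integrable integrands, which is why affinity is asked
only along segments of `S`. -/
theorem segmentAffine_expect {D : MomentData m k} {S : Set (ℝ → ℝ)} {g : ℝ → ℝ}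
    (hint : ∀ i, ∀ L ∈ S, Integrable (fun x => momentFn D i x * L x) (densityMeasure g)) :
    SegmentAffine S (momentMap (expect g) D) := by
  refine segmentAffine_momentMap fun i L hL L' hL' a b => ?_
  simp only [expect]
  rw [← integral_const_mul, ← integral_const_mul,
    ← integral_add ((hint i L hL).const_mul a) ((hint i L' hL').const_mul b)]
  exact integral_congr_ae (ae_of_all _ fun y => by ring)

end Moments

/-! ### Almost sure properties of the sample, and the uniform deviation of sample means. -/

section Sampling

theorem isProbabilityMeasure_densityMeasure {g : ℝ → ℝ} (hg : IsPositiveDensity g) :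
    IsProbabilityMeasure (densityMeasure g) :=
  ⟨by rw [densityMeasure, withDensity_apply _ MeasurableSet.univ, Measure.restrict_univ]; exact hg.2.2⟩

/-- The moment function `φ` is measurable only up to a null set. A measurable version `ψ` has the
same integrals and the same values at the sample points, and its envelope is measurable. -/
theorem enorm_sampleMean_sub_expect_le {Ω : Type*} {X : ℕ → Ω → ℝ} {M γ c : ℝ} {g₀ : ℝ → ℝ}
    (hM : 0 < M) (hγ : γ ∈ Set.Ioo (0 : ℝ) 1)
    (hg₀ : IsPositiveDensity g₀) (huni : UnimodalAbout c g₀) {φ ψ : ℝ → ℝ}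
    (hψm : Measurable ψ)
    (hψ : Integrable ψ (densityMeasure g₀)) (hae : φ =ᵐ[densityMeasure g₀] ψ) {ω : Ω}
    (hω : ∀ i, φ (X i ω) = ψ (X i ω)) {L : ℝ → ℝ}
    (hL : L ∈ likelihoodRatios (shapeClass M γ c g₀) g₀) {n : ℕ} (hn : 1 ≤ n) :
    ‖sampleMean (sample X n ω) (fun y => φ y * L y) - expect g₀ fun y => φ y * L y‖ₑ ≤
      meanEnvelope (densityMeasure g₀) M γ c g₀ ψ X n ω := by
  have hn0 : (0 : ℝ) < n := by exact_mod_cast hn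
  have h1 : sampleMean (sample X n ω) (fun y => φ y * L y) - (expect g₀ fun y => φ y * L y) =
      centredSum (densityMeasure g₀) (fun y => ψ y * L y) (sample X n ω) / n := by
    have h2 : (expect g₀ fun y => φ y * L y) = ∫ y, ψ y * L y ∂(densityMeasure g₀) :=
      integral_congr_ae (by filter_upwards [hae] with y hy; rw [hy])
    have h3 : ∀ i, φ (sample X n ω i) = ψ (sample X n ω i) := fun i => hω i
    simp only [sampleMean, centredSum, h2, h3, Finset.sum_sub_distrib, Finset.sum_const,
      Finset.card_univ, Fintype.card_fin, nsmul_eq_mul]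
    field_simp
  rw [h1, meanEnvelope, Real.enorm_eq_ofReal_abs, abs_div, abs_of_pos hn0,
    ENNReal.ofReal_div_of_pos hn0, ENNReal.ofReal_natCast, ← Real.enorm_eq_ofReal_abs]
  gcongr
  exact enorm_centredSum_le_shellEnvelope hM hγ hg₀.1 hg₀.2.1 huni hψm hψ hL _

variable {Ω : Type*} [MeasurableSpace Ω] {P : Measure Ω} {X : ℕ → Ω → ℝ}

/-- Independent variables with a density are almost surely pairwise distinct. -/
theorem ae_injective_sample [IsProbabilityMeasure P] {g : ℝ → ℝ} (hg : IsPositiveDensity g)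
    (hX : ∀ i, Measurable (X i)) (hindep : iIndepFun X P)
    (hlaw : ∀ i, P.map (X i) = densityMeasure g) :
    ∀ᵐ ω ∂P, ∀ n, Function.Injective (sample X n ω) := by
  have := isProbabilityMeasure_densityMeasure hg
  have hatom : ∀ a, densityMeasure g {a} = 0 := fun a =>
    withDensity_absolutelyContinuous _ _ (by simp)
  have hpair : ∀ i j : ℕ, i ≠ j → ∀ᵐ ω ∂P, X i ω ≠ X j ω := by
    intro i j hij
    have hmap := (indepFun_iff_map_prod_eq_prod_map_map (hX i).aemeasurable
      (hX j).aemeasurable).1 (hindep.indepFun hij)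
    rw [hlaw, hlaw] at hmap
    have hdiag : MeasurableSet {z : ℝ × ℝ | z.1 = z.2} :=
      measurableSet_eq_fun measurable_fst measurable_snd
    have h0 : ((densityMeasure g).prod (densityMeasure g)) {z : ℝ × ℝ | z.1 = z.2} = 0 := by
      rw [Measure.measure_prod_null hdiag]
      refine ae_of_all _ fun a => ?_
      have : Prod.mk a ⁻¹' {z : ℝ × ℝ | z.1 = z.2} = {a} := by
        ext b
        simp [eq_comm]
      show densityMeasure g (Prod.mk a ⁻¹' {z : ℝ × ℝ | z.1 = z.2}) = 0
      rw [this, hatom]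
    rw [← hmap, Measure.map_apply ((hX i).prodMk (hX j)) hdiag] at h0
    exact measure_eq_zero_iff_ae_notMem.1 h0
  have hall : ∀ᵐ ω ∂P, ∀ i j : ℕ, i ≠ j → X i ω ≠ X j ω := by
    rw [ae_all_iff]
    intro i
    rw [ae_all_iff]
    intro j
    by_cases hij : i = j
    · exact ae_of_all _ fun ω h => absurd hij h
    · filter_upwards [hpair i j hij] with ω hω _ using hω
  filter_upwards [hall] with ω hω n i j hij
  by_contra hne
  exact hω i j (fun h => hne (Fin.ext h)) hij

/-- Properties that hold almost everywhere for the law hold along almost every sample. -/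
theorem ae_forall_sample {μ : Measure ℝ} (hX : ∀ i, Measurable (X i))
    (hlaw : ∀ i, P.map (X i) = μ) {p : ℝ → Prop} (hp : ∀ᵐ y ∂μ, p y) : ∀ᵐ ω ∂P, ∀ i, p (X i ω) := by
  rw [ae_all_iff]
  intro i
  rw [← hlaw i] at hp
  exact ae_of_ae_map (hX i).aemeasurable hp

end Sampling

/-! ### Consequences for optimal values -/

section Rates

variable {Ω : Type*} [MeasurableSpace Ω] {P : Measure Ω}
  {V : ℕ → Ω → EReal} {v : EReal} {H : ℕ → Ω → ℝ≥0∞} {η C : ℝ}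

theorem outerAlmostSurelyTendsto_of_bound [IsProbabilityMeasure P] (hη : 0 < η)
    (hH : ∀ n, Measurable (H n)) (hlim : ∀ᵐ ω ∂P, Tendsto (fun n => H n ω) atTop (𝓝 0))
    (hgap : ∀ᵐ ω ∂P, ∀ n : ℕ, 1 ≤ n → ∀ Δ : ℝ, 0 < Δ → Δ ≤ η → H n ω ≤ ENNReal.ofReal Δ →
      gap (V n ω) v ≤ ENNReal.ofReal (C * Δ)) :
    OuterAlmostSurelyTendsto P V v := by
  -- The extra term makes `G` positive, as `hgap` requires of `Δ`. The majorant is set to `⊤` where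
  -- `G` exceeds `η`, which almost surely ceases for large `n`.
  let G : ℕ → Ω → ℝ≥0∞ := fun n ω => H n ω + ENNReal.ofReal (1 / ((n : ℝ) + 1))
  have hG : ∀ n, Measurable (G n) := fun n => (hH n).add_const _
  refine OuterAlmostSurelyTendsto.of_le
    (fun n ω => if G n ω ≤ ENNReal.ofReal η then ENNReal.ofReal C * G n ω else ⊤)
    (fun n => Measurable.ite (measurableSet_le (hG n) measurable_const) ((hG n).const_mul _)
      measurable_const) (fun n hn => ?_) ?_
  · filter_upwards [hgap] with ω hω
    split_ifs with h
    · have hfin : G n ω ≠ ⊤ := ne_top_of_le_ne_top ENNReal.ofReal_ne_top h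
      have hpos : 0 < (G n ω).toReal := by
        refine ENNReal.toReal_pos (ne_of_gt ?_) hfin
        refine lt_of_lt_of_le (ENNReal.ofReal_pos.2 ?_) le_add_self
        positivity
      have h1 := hω n hn (G n ω).toReal hpos (ENNReal.toReal_le_of_le_ofReal hη.le h) (by
        rw [ENNReal.ofReal_toReal hfin]
        exact le_self_add)
      rwa [ENNReal.ofReal_mul' hpos.le, ENNReal.ofReal_toReal hfin] at h1
    · exact le_top
  · filter_upwards [hlim] with ω hω
    have hG0 : Tendsto (fun n => G n ω) atTop (𝓝 0) := by
      have h := hω.add (ENNReal.tendsto_ofReal (tendsto_one_div_add_atTop_nhds_zero_nat (𝕜 := ℝ)))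
      rwa [ENNReal.ofReal_zero, add_zero] at h
    have h1 : Tendsto (fun n => ENNReal.ofReal C * G n ω) atTop (𝓝 0) := by
      simpa using ENNReal.Tendsto.const_mul hG0 (Or.inr ENNReal.ofReal_ne_top)
    refine h1.congr' ?_
    filter_upwards [hG0.eventually_le_const (ENNReal.ofReal_pos.2 hη)] with n hn
    rw [if_pos hn]

theorem rootNBounded_of_bound (hη : 0 < η) (hC : 0 < C) {A : ℝ} (hA : 0 < A)
    (hH : ∀ n, Measurable (H n))
    (hmean : ∀ n : ℕ, 1 ≤ n → ∫⁻ ω, H n ω ∂P ≤ ENNReal.ofReal (A / √n))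
    (hgap : ∀ᵐ ω ∂P, ∀ n : ℕ, 1 ≤ n → ∀ Δ : ℝ, 0 < Δ → Δ ≤ η → H n ω ≤ ENNReal.ofReal Δ →
      gap (V n ω) v ≤ ENNReal.ofReal (C * Δ)) :
    RootNBounded P V v := by
  intro ε hε
  set κ := A / ε with hκ
  have hκ0 : 0 < κ := by positivity
  -- By Markov's inequality `H n` reaches `κ / √n` with probability at most `A / κ = ε`. Otherwise
  -- the scaled gap is at most `C * κ`, and the factor `2` makes this strictly smaller than the
  -- threshold.
  refine ⟨2 * C * κ, by positivity, ?_⟩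
  refine limsup_le_of_le (h := ?_)
  have hsmall : ∀ᶠ n : ℕ in atTop, κ / √n ≤ η := by
    have : Tendsto (fun n : ℕ => κ / √(n : ℝ)) atTop (𝓝 0) :=
      (Real.tendsto_sqrt_atTop.comp tendsto_natCast_atTop_atTop).const_div_atTop κ
    exact this.eventually_le_const hη
  filter_upwards [hsmall, eventually_ge_atTop 1] with n hnη hn
  have hsn : 0 < √(n : ℝ) := Real.sqrt_pos.2 (by exact_mod_cast hn)
  have hΔ : 0 < κ / √n := by positivity
  have hsub : {ω | ENNReal.ofReal (2 * C * κ) ≤ ENNReal.ofReal √n * gap (V n ω) v} ≤ᵐ[P]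
      {ω | ENNReal.ofReal (κ / √n) ≤ H n ω} := by
    filter_upwards [hgap] with ω hω (hmem : _ ≤ _)
    show ENNReal.ofReal (κ / √n) ≤ H n ω
    by_contra hlt
    have h1 := hω n hn _ hΔ hnη (not_le.1 hlt).le
    have h2 : ENNReal.ofReal (2 * C * κ) ≤ ENNReal.ofReal (C * κ) := by
      refine hmem.trans ((mul_le_mul_right h1 _).trans (le_of_eq ?_))
      rw [← ENNReal.ofReal_mul hsn.le]
      congr 1
      field_simp
    rw [ENNReal.ofReal_le_ofReal_iff (by positivity)] at h2
    nlinarith [mul_pos hC hκ0]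
  calc P {ω | ENNReal.ofReal (2 * C * κ) ≤ ENNReal.ofReal √n * gap (V n ω) v}
      ≤ P {ω | ENNReal.ofReal (κ / √n) ≤ H n ω} := measure_mono_ae hsub
    _ ≤ (∫⁻ ω, H n ω ∂P) / ENNReal.ofReal (κ / √n) :=
        meas_ge_le_lintegral_div (hH n).aemeasurable (ENNReal.ofReal_pos.2 hΔ).ne'
          ENNReal.ofReal_ne_top
    _ ≤ ENNReal.ofReal (A / √n) / ENNReal.ofReal (κ / √n) := by
        gcongr
        exact hmean n hn
    _ = ENNReal.ofReal ε := by
        rw [← ENNReal.ofReal_div_of_pos hΔ, hκ]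
        congr 1
        field_simp

end Rates

/-- A measurable bound, of mean order `1 / √n` and converging to zero almost surely, that controls
the optimal values of the sampled problems. -/
theorem exists_gap_bound {m k : ℕ} (D : MomentData m k) {M γ c : ℝ} (hM : 0 < M)
    (hγ : γ ∈ Set.Ioo (0 : ℝ) 1) {g₀ : ℝ → ℝ} (hg₀ : IsPositiveDensity g₀)
    (hg₀_uni : UnimodalAbout c g₀) (hmem : ∀ i, MemLp (momentFn D i) 2 (densityMeasure g₀))
    (hslater : SlaterCondition (expect g₀) D (likelihoodRatios (shapeClass M γ c g₀) g₀))
    {Ω : Type*} [MeasurableSpace Ω] {P : Measure Ω} [IsProbabilityMeasure P]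
    {X : ℕ → Ω → ℝ} (hX : ∀ i, Measurable (X i)) (hindep : iIndepFun X P)
    (hlaw : ∀ i, P.map (X i) = densityMeasure g₀) :
    ∃ (H : ℕ → Ω → ℝ≥0∞) (η C A : ℝ), 0 < η ∧ 0 < C ∧ 0 < A ∧ (∀ n, Measurable (H n)) ∧
      (∀ᵐ ω ∂P, Tendsto (fun n => H n ω) atTop (𝓝 0)) ∧
      (∀ n : ℕ, 1 ≤ n → ∫⁻ ω, H n ω ∂P ≤ ENNReal.ofReal (A / √n)) ∧
      ∀ᵐ ω ∂P, ∀ n : ℕ, 1 ≤ n → ∀ Δ : ℝ, 0 < Δ → Δ ≤ η → H n ω ≤ ENNReal.ofReal Δ →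
        gap (optimalValue (sampleMean (sample X n ω)) D
            (likelihoodRatios (shapeClass M γ c g₀) g₀))
          (optimalValue (expect g₀) D (likelihoodRatios (shapeClass M γ c g₀) g₀)) ≤
          ENNReal.ofReal (C * Δ) := by
  have hprob := isProbabilityMeasure_densityMeasure hg₀
  set μ := densityMeasure g₀ with hμ
  set 𝓛 := likelihoodRatios (shapeClass M γ c g₀) g₀ with h𝓛
  have hpos := hg₀.1
  have hg := hg₀.2.1
  have hint : ∀ i, Integrable (momentFn D i) μ := fun i => (hmem i).integrable (by norm_num)
  have hintL : ∀ i, ∀ L ∈ 𝓛, Integrable (fun x => momentFn D i x * L x) μ := fun i L hL =>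
    integrable_mul_likelihoodRatio hM hγ hpos hg hg₀_uni (hint i) hL
  -- the deterministic part
  set b := M * (M * g₀ c) ^ (1 / (1 - γ) - 1) with hb
  have hb0 : 0 ≤ b := mul_nonneg hM.le (Real.rpow_nonneg (mul_pos hM (hpos c)).le _)
  have hB : ∀ L ∈ 𝓛, ‖momentMap (expect g₀) D L‖ ≤ ∑ i, b * ∫ y, |momentFn D i y| ∂μ := by
    intro L hL
    refine norm_momentMap_le fun i => ?_
    have h1 : |∫ y, momentFn D i y * L y ∂μ| ≤ b * ∫ y, |momentFn D i y| ∂μ := by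
      refine abs_integral_le_integral_abs.trans ?_
      rw [← integral_const_mul]
      refine integral_mono (hintL i L hL).abs ((hint i).abs.const_mul b) fun y => ?_
      simp only [abs_mul]
      rw [mul_comm]
      exact mul_le_mul_of_nonneg_right (likelihoodRatio_bound hM hγ hpos hg₀_uni hL y)
        (abs_nonneg _)
    refine h1.trans (Finset.single_le_sum (f := fun i => b * ∫ y, |momentFn D i y| ∂μ)
      (fun j _ => mul_nonneg hb0 (integral_nonneg fun y => abs_nonneg _)) (Finset.mem_univ i))
  obtain ⟨η, hη, C, hC, hstab⟩ := abstractValue_stable (convex_likelihoodRatios M γ c g₀)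
    (segmentAffine_expect hintL) hB hslater.1 hslater.2
  -- the random part
  choose ψ hψm hψ using fun i => (hmem i).aestronglyMeasurable
  have hψm' : ∀ i, Measurable (ψ i) := fun i => (hψm i).measurable
  have hψmem : ∀ i, MemLp (ψ i) 2 μ := fun i => (memLp_congr_ae (hψ i)).1 (hmem i)
  have hψint : ∀ i, Integrable (ψ i) μ := fun i => (hψmem i).integrable (by norm_num)
  choose A hA hmean using fun i => exists_lintegral_meanEnvelope_le (c := c) hX hindep hlaw hM hγ
    hpos hg (hψm' i) (hψmem i)
  have hHm : ∀ i n, Measurable (meanEnvelope μ M γ c g₀ (ψ i) X n) := fun i n =>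
    measurable_meanEnvelope hX hg (hψm' i) n
  refine ⟨fun n ω => ∑ i, meanEnvelope μ M γ c g₀ (ψ i) X n ω, η, C, ∑ i, A i, hη, hC,
    Finset.sum_pos (fun i _ => hA i) Finset.univ_nonempty,
    fun n => Finset.measurable_sum _ fun i _ => hHm i n, ?_, fun n hn => ?_, ?_⟩
  · have h1 : ∀ᵐ ω ∂P, ∀ i, Tendsto (fun n => meanEnvelope μ M γ c g₀ (ψ i) X n ω) atTop (𝓝 0) :=
      ae_all_iff.2 fun i => ae_tendsto_meanEnvelope hX hindep hlaw hM hγ hpos hg (hψm' i) (hψmem i)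
    filter_upwards [h1] with ω hω
    simpa using tendsto_finsetSum Finset.univ fun i _ => hω i
  · rw [lintegral_finsetSum _ fun i _ => hHm i n, Finset.sum_div,
      ENNReal.ofReal_sum_of_nonneg fun i _ => div_nonneg (hA i).le (Real.sqrt_nonneg _)]
    exact Finset.sum_le_sum fun i _ => hmean i n hn
  · have h1 : ∀ᵐ ω ∂P, ∀ i, ∀ t, momentFn D i (X t ω) = ψ i (X t ω) :=
      ae_all_iff.2 fun i => ae_forall_sample hX hlaw (p := fun y => momentFn D i y = ψ i y) (hψ i)
    filter_upwards [h1] with ω hω n hn Δ hΔ hΔη hle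
    -- `abstractValue` of a `momentMap` unfolds to `optimalValue`.
    refine hstab _ (segmentAffine_sampleMean D 𝓛 _) Δ hΔ hΔη fun L hL => ?_
    refine norm_momentMap_sub_le fun i => ?_
    have h2 := enorm_sampleMean_sub_expect_le hM hγ hg₀ hg₀_uni (hψm' i)
      (hψint i) (hψ i) (hω i) hL hn
    have h3 := (h2.trans (Finset.single_le_sum
      (f := fun i => meanEnvelope μ M γ c g₀ (ψ i) X n ω) (fun _ _ => zero_le)
      (Finset.mem_univ i))).trans hle
    rw [Real.enorm_eq_ofReal_abs] at h3
    exact (ENNReal.ofReal_le_ofReal_iff hΔ.le).1 h3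

end IWSAA

theorem corollary4
    {m k : ℕ} (D : IWSAA.MomentData m k)
    (M γ c δ : ℝ) (hM : 0 < M) (hγ : γ ∈ Set.Ioo (0 : ℝ) 1) (hδ : 0 < δ)
    (g₀ : ℝ → ℝ) (hg₀ : IWSAA.IsPositiveDensity g₀) (hg₀_uni : IWSAA.UnimodalAbout c g₀)
    (hobj : MemLp D.obj (ENNReal.ofReal (2 + δ)) (IWSAA.densityMeasure g₀))
    (hineq : ∀ j, MemLp (D.ineq j) (ENNReal.ofReal (2 + δ)) (IWSAA.densityMeasure g₀))
    (heq : ∀ j, MemLp (D.eq j) (ENNReal.ofReal (2 + δ)) (IWSAA.densityMeasure g₀))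
    (𝓛 : Set (ℝ → ℝ)) (h𝓛 : 𝓛 = IWSAA.likelihoodRatios (IWSAA.shapeClass M γ c g₀) g₀)
    (hslater : IWSAA.SlaterCondition (IWSAA.expect g₀) D 𝓛)
    {Ω : Type*} [MeasurableSpace Ω] (P : Measure Ω) [IsProbabilityMeasure P]
    (X : ℕ → Ω → ℝ) (hX : ∀ i, Measurable (X i)) (hindep : iIndepFun X P)
    (hlaw : ∀ i, P.map (X i) = IWSAA.densityMeasure g₀) :
    -- almost surely, for every sample size, the sampled problem reduces to a linear program
    (∀ᵐ ω ∂P, ∀ n : ℕ, 1 ≤ n → ∀ x : Fin n → ℝ, x = IWSAA.sample X n ω →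
      ((fun (L : ℝ → ℝ) (i : Fin n) => L (x i)) '' 𝓛 = IWSAA.discreteShape M γ c g₀ x) ∧
      ((fun (L : ℝ → ℝ) (i : Fin n) => L (x i)) ''
          IWSAA.feasibleSet (IWSAA.sampleMean x) D 𝓛 =
        IWSAA.discreteFeasibleSet D x (IWSAA.discreteShape M γ c g₀ x)) ∧
      (IWSAA.optimalValue (IWSAA.sampleMean x) D 𝓛 =
        IWSAA.discreteOptimalValue D x (IWSAA.discreteShape M γ c g₀ x)) ∧
      IWSAA.IsLinearProgram (IWSAA.discreteObjective D x)
        (IWSAA.discreteFeasibleSet D x (IWSAA.discreteShape M γ c g₀ x))) ∧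
    -- consistency
    IWSAA.OuterAlmostSurelyTendsto P
      (fun n ω => IWSAA.optimalValue (IWSAA.sampleMean (IWSAA.sample X n ω)) D 𝓛)
      (IWSAA.optimalValue (IWSAA.expect g₀) D 𝓛) ∧
    -- convergence at the rate `√n`
    IWSAA.RootNBounded P
      (fun n ω => IWSAA.optimalValue (IWSAA.sampleMean (IWSAA.sample X n ω)) D 𝓛)
      (IWSAA.optimalValue (IWSAA.expect g₀) D 𝓛) := by
  subst h𝓛
  have h2 : (2 : ℝ≥0∞) ≤ ENNReal.ofReal (2 + δ) := by
    rw [← ENNReal.ofReal_ofNat]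
    exact ENNReal.ofReal_le_ofReal (by linarith)
  have := IWSAA.isProbabilityMeasure_densityMeasure hg₀
  have hmem : ∀ i, MemLp (IWSAA.momentFn D i) 2 (IWSAA.densityMeasure g₀) := by
    rintro (_ | j | j)
    · exact hobj.mono_exponent h2
    · exact (hineq j).mono_exponent h2
    · exact (heq j).mono_exponent h2
  obtain ⟨H, η, C, A, hη, hC, hA, hH, hlim, hmean, hgap⟩ :=
    IWSAA.exists_gap_bound D hM hγ hg₀ hg₀_uni hmem hslater hX hindep hlaw
  refine ⟨?_, IWSAA.outerAlmostSurelyTendsto_of_bound hη hH hlim hgap,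
    IWSAA.rootNBounded_of_bound hη hC hA hH hmean hgap⟩
  filter_upwards [IWSAA.ae_injective_sample hg₀ hX hindep hlaw] with ω hω n _ x hx
  have hinj : Function.Injective x := hx ▸ hω n
  have himage := IWSAA.image_likelihoodRatios_eq_discreteShape hM hγ hg₀.1 hg₀_uni hinj
  exact ⟨himage, IWSAA.image_feasibleSet_eq D himage,
    IWSAA.optimalValue_eq_discreteOptimalValue D himage,
    IWSAA.isLinearProgram_discrete D M γ c g₀ x⟩
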